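/- **Setting.** Let $n\ge 1$ and consider on $\mathbb R^n\times(0,\infty)$ the problem $$\partial_t u-\Delta\partial_t u=\Delta u+a(x,t)\,u,\qquad u(x,0)=u_0(x).\tag{1}$$ Let $\mathcal B=(1-\Delta)^{-1}$ be the Bessel potential operator, $\mathcal Bg=B*g$ with $B(x)=(2\pi)^{-n/2}|x|^{1-n/2}K_{n/2-1}(|x|)$, where $K_\nu$ is the modified Bessel function of the second kind. For $\rho\in[0,1)$ let $\mathcal E_\rho=L^1(\mathbb R^n,e^{-\rho|x|}dx)$, and let $\mathcal E=\bigcup_{0\le\rho<1}\mathcal E_\rho$, with the (locally convex) inductive limit topology. Put $V=a+1$. A (global mild) solution of (1) is a function $u\in C([0,\infty);\mathcal E)$ such that $\mu(t):=e^tu(t)$ satisfies, for every $t\ge0$ and almost every $x$, $$\mu(t)=u_0+\int_0^t\mathcal B\bigl(V(\cdot,\tau)\mu(\tau)\bigr)\,d\tau ,$$ the integrals being convergent. For a function $\varphi$ on $\mathbb R^n$ define $\widehat{\mathcal B}V(t)^0\varphi=\varphi$ and $$\widehat{\mathcal B}V(t)^{k+1}\varphi=\int_0^t\mathcal B\bigl(V(\cdot,\tau)\,\widehat{\mathcal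 B}V(\tau)^k\varphi\bigr)\,d\tau .$$ **Theorem (Global well-posedness II).** Let $a\in L^1_{loc}(\mathbb R^n\times[0,\infty))$ satisfy $|a(x,t)|\le\varLambda(t)|x|^\sigma$ for almost every $(x,t)\in\mathbb R^n\times[0,\infty)$, where $\sigma\in[0,1)$ and $\varLambda$ satisfies $\sup_{[0,T]}\varLambda<\infty$ for every $T<\infty$. Then for every $u_0\in\mathcal E$ the problem (1) has a unique global mild solution $u\in C([0,\infty);\mathcal E)$. Moreover: 1. all the terms $\widehat{\mathcal B}V(t)^ku_0$ are well defined almost everywhere, and for every $t\ge0$ $$e^tu(t)=\sum_{k=0}^\infty\widehat{\mathcal B}V(t)^ku_0\quad\text{almost everywhere on }\mathbb R^n;$$ for every $T<\infty$ there is $\rho\in[0,1)$ such that the partial sums also converge to $e^tu(t)$ in the norm of $\mathcal E_\rho$, uniformly in $t\in[0,T]$; 2. if $a\ge0$ and $u_0\ge0$ almost everywhere, then $u(t)\ge0$ almost everywhere for every $t\ge0$. -/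

import Mathlib

open MeasureTheory Set Filter Topology
open scoped NNReal

noncomputable section

/-- The space `ℝⁿ` with its Euclidean norm. -/
abbrev Rn (n : ℕ) : Type := EuclideanSpace ℝ (Fin n)

/-! ### The Bessel potential operator -/

/-- The modified Bessel function of the second kind `K_ν(r)`, for `r > 0`, by its standard
integral representation `K_ν(r) = ∫₀^∞ exp(-r cosh s) cosh(ν s) ds`. -/
def besselK (ν r : ℝ) : ℝ :=
  ∫ s in Ioi (0 : ℝ), Real.exp (-r * Real.cosh s) * Real.cosh (ν * s)

/-- The kernel of `(1 - Δ)⁻¹` on `ℝⁿ`: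
`B(x) = (2π)^(-n/2) |x|^(1 - n/2) K_{n/2 - 1}(|x|)` (the value at `x = 0` is irrelevant). -/
def besselKernel (n : ℕ) (x : Rn n) : ℝ :=
  (2 * Real.pi) ^ (-(n : ℝ) / 2) * ‖x‖ ^ (1 - (n : ℝ) / 2) * besselK ((n : ℝ) / 2 - 1) ‖x‖

/-- The Bessel potential `(𝓑 g)(x) = ∫ B(x - y) g(y) dy`. -/
def besselPotential {n : ℕ} (g : Rn n → ℝ) (x : Rn n) : ℝ :=
  ∫ y, besselKernel n (x - y) * g y

/-- For `w` depending on time and space,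
`(𝓑̂V(t) w)(x) = ∫₀ᵗ 𝓑(V(·,τ) w(τ))(x) dτ = ∫₀ᵗ ∫ B(x - y) V(y,τ) w(y,τ) dy dτ`. -/
def hatB {n : ℕ} (V : Rn n → ℝ → ℝ) (w : ℝ → Rn n → ℝ) (t : ℝ) (x : Rn n) : ℝ :=
  ∫ τ in (0 : ℝ)..t, besselPotential (fun y => V y τ * w τ y) x

/-- The iterated integral `(𝓑̂V(t) w)(x)` makes sense: the inner integrand is integrable for almost
every `τ ∈ (0,t]`, and the resulting function of `τ` is integrable on `(0,t]`. -/
def HatBDefined {n : ℕ} (V : Rn n → ℝ → ℝ) (w : ℝ → Rn n → ℝ) (t : ℝ) (x : Rn n) : Prop :=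
  (∀ᵐ τ ∂(volume.restrict (Ioc (0 : ℝ) t)),
    Integrable (fun y => besselKernel n (x - y) * (V y τ * w τ y))) ∧
  IntervalIntegrable (fun τ => besselPotential (fun y => V y τ * w τ y) x) volume 0 t

/-- The terms `𝓑̂V(t)^k φ` of the Picard series: `𝓑̂V(t)^0 φ = φ` and
`𝓑̂V(t)^(k+1) φ = ∫₀ᵗ 𝓑(V(·,τ) 𝓑̂V(τ)^k φ) dτ`. -/
def picardTerm {n : ℕ} (V : Rn n → ℝ → ℝ) (φ : Rn n → ℝ) : ℕ → ℝ → Rn n → ℝ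
  | 0 => fun _ => φ
  | k + 1 => hatB V (picardTerm V φ k)

/-! ### The space `𝓔` -/

/-- `𝓔_ρ = L¹(ℝⁿ, e^{-ρ|x|} dx)`, a space of classes of functions modulo equality almost
everywhere. Its members are locally integrable, the weight being bounded below on bounded sets. -/
def weightedL1 (n : ℕ) (ρ : ℝ) : Submodule ℝ (Rn n →ₘ[volume] ℝ) where
  carrier := {f | Integrable (fun x => Real.exp (-ρ * ‖x‖) * f x)}
  zero_mem' := by
    have h : (fun x : Rn n => Real.exp (-ρ * ‖x‖) * (0 : Rn n →ₘ[volume] ℝ) x)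
        =ᵐ[volume] fun _ => 0 := by
      filter_upwards [AEEqFun.coeFn_zero (α := Rn n) (μ := volume) (β := ℝ)] with x hx
      simp [hx]
    exact (integrable_congr h).2 (integrable_zero _ _ _)
  add_mem' := by
    intro f g hf hg
    refine (integrable_congr ?_).2 (Integrable.add hf hg)
    filter_upwards [AEEqFun.coeFn_add f g] with x hx
    simp [hx, mul_add]
  smul_mem' := by
    intro c f hf
    refine (integrable_congr ?_).2 (Integrable.smul c hf)
    filter_upwards [AEEqFun.coeFn_smul c f] with x hx
    simp [hx, mul_left_comm]

/-- The norm of `𝓔_ρ`. -/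
def weightedNorm {n : ℕ} (ρ : ℝ) (f : Rn n →ₘ[volume] ℝ) : ℝ :=
  ∫ x, Real.exp (-ρ * ‖x‖) * |f x|

theorem weightedL1_mono {n : ℕ} {ρ ρ' : ℝ} (h : ρ ≤ ρ') : weightedL1 n ρ ≤ weightedL1 n ρ' := by
  intro f hf
  refine Integrable.mono hf ?_ (ae_of_all _ fun x => ?_)
  · exact (by fun_prop : Continuous fun x : Rn n =>
      Real.exp (-ρ' * ‖x‖)).aestronglyMeasurable.mul f.aestronglyMeasurable
  · simp only [norm_mul, Real.norm_eq_abs, Real.abs_exp]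
    have := norm_nonneg x
    gcongr

/-- `𝓔 = ⋃_{ρ ∈ [0,1)} 𝓔_ρ` as a vector space. -/
def expSubmodule (n : ℕ) : Submodule ℝ (Rn n →ₘ[volume] ℝ) where
  carrier := {f | ∃ ρ ∈ Ico (0 : ℝ) 1, f ∈ weightedL1 n ρ}
  zero_mem' := ⟨0, by simp, zero_mem _⟩
  add_mem' := by
    rintro f g ⟨ρ, hρ, hf⟩ ⟨ρ', hρ', hg⟩
    exact ⟨max ρ ρ', ⟨le_max_of_le_left hρ.1, max_lt hρ.2 hρ'.2⟩,
      add_mem (weightedL1_mono (le_max_left _ _) hf) (weightedL1_mono (le_max_right _ _) hg)⟩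
  smul_mem' := by
    rintro c f ⟨ρ, hρ, hf⟩
    exact ⟨ρ, hρ, Submodule.smul_mem _ c hf⟩

/-- The space `𝓔`, with the topology given below. -/
def ExpSpace (n : ℕ) : Type := expSubmodule n

instance (n : ℕ) : AddCommGroup (ExpSpace n) := inferInstanceAs (AddCommGroup (expSubmodule n))

instance (n : ℕ) : Module ℝ (ExpSpace n) := inferInstanceAs (Module ℝ (expSubmodule n))

/-- The underlying class of functions of an element of `𝓔`. -/
def ExpSpace.toAE {n : ℕ} (f : ExpSpace n) : Rn n →ₘ[volume] ℝ := f.1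

/-- The seminorms on `𝓔` whose restriction to every Banach space `𝓔_ρ`, `ρ ∈ [0,1)`, is
continuous. -/
def StepContinuousSeminorm (n : ℕ) : Type :=
  {p : Seminorm ℝ (ExpSpace n) // ∀ ρ ∈ Ico (0 : ℝ) 1, ∃ C : ℝ, ∀ f : ExpSpace n,
    f.toAE ∈ weightedL1 n ρ → p f ≤ C * weightedNorm ρ f.toAE}

instance (n : ℕ) : Nonempty (StepContinuousSeminorm n) :=
  ⟨⟨0, fun _ _ => ⟨0, fun _ _ => by simp⟩⟩⟩

/-- The family of all these seminorms. -/
def stepSeminorms (n : ℕ) : SeminormFamily ℝ (ExpSpace n) (StepContinuousSeminorm n) :=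
  fun p => p.1

/-- `𝓔 = ⋃ 𝓔_ρ` carries the inductive limit topology, i.e. the finest locally convex topology for
which all inclusions `𝓔_ρ → 𝓔` are continuous; it is the topology generated by all seminorms
that are continuous on each `𝓔_ρ`. -/
instance (n : ℕ) : TopologicalSpace (ExpSpace n) :=
  (stepSeminorms n).moduleFilterBasis.topology

/-! ### Mild solutions -/

/-- `u ∈ C([0,∞); 𝓔)` is a (global, mild) solution of
`∂ₜu - Δ∂ₜu = Δu + a u`, `u(0) = u₀`: with `V = a + 1`, the function `μ(t) = eᵗ u(t)` satisfies
`μ(t) = u₀ + ∫₀ᵗ 𝓑(V(·,τ) μ(τ)) dτ` for all `t ≥ 0` (as an identity in `𝓔`, i.e. a.e. in `x`). -/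
def IsMildSolution {n : ℕ} (a : Rn n → ℝ → ℝ) (u₀ : ExpSpace n) (u : C(ℝ≥0, ExpSpace n)) : Prop :=
  let V : Rn n → ℝ → ℝ := fun x t => a x t + 1
  let μ : ℝ → Rn n → ℝ := fun t x => Real.exp t * (u t.toNNReal).toAE x
  ∀ t : ℝ, 0 ≤ t → ∀ᵐ x : Rn n,
    HatBDefined V μ t x ∧ μ t x = u₀.toAE x + hatB V μ t x

end

/-!
On `[0,T]` the potential `V = a + 1` is bounded by `C (1 + |x|^σ)`, and the Bessel kernel `B` has
finite exponential moments `∫ B(z) e^{ρ|z|} dz` for `ρ < 1` (`besselMoment_lt_top`). Multiplication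
by `V` maps `𝓔_ρ` to `𝓔_{ρ+δ}` with norm `O(δ^{-σ})`, and convolution with `B` preserves `𝓔_{ρ+δ}`
as long as `ρ + δ < 1`. Passing from `ρ₀` to `ρ₁ < 1` in `k` equal steps, the `k`-th iterate of
`𝓑̂V` has norm at most `(D k^σ)^k / k!` from `𝓔_ρ₀` to `𝓔_ρ₁`: the factorial comes from the time
integrals, and the bound is summable because `σ < 1` (`exists_summable_bound`).

The estimates are carried out for the positive operator `majorant` acting on functions with values
in `[0,∞]`, which dominates `𝓑̂V` pointwise. There Tonelli's theorem needs measurability only, so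
`a` is first replaced by a measurable potential which obeys its growth bound everywhere
(`exists_growthBound_ae_eq`); no term of the Picard series changes. Where the series of the
iterates of the majorant is finite, that is almost everywhere, all Picard terms are well defined
and their sum solves the integral equation (`picardSum_eq`).

Uniqueness uses the inductive limit topology in two ways. A continuous curve maps `[0,T]` to a
bounded subset of a single `𝓔_ρ`, by a gliding hump argument with the continuous seminorms
`f ↦ ∫ g |f|`, where `g = O(e^{-ρ|x|})` for all `ρ < 1` (`exists_step_bound`). It also has a jointly
measurable version, obtained by averaging over small balls (`exists_measurable_version`). The
difference of two solutions is then dominated by its own majorant, hence by all iterates of the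
majorant, and these tend to zero (`ae_eq_zero_of_le_majorant`).
-/

open MeasureTheory Set Filter Topology
open scoped NNReal

noncomputable section

/-! ### Exponential moments of the Bessel kernel -/

theorem besselK_nonneg (ν r : ℝ) : 0 ≤ besselK ν r :=
  integral_nonneg fun _ => mul_nonneg (Real.exp_pos _).le (Real.cosh_pos _).le

theorem besselKernel_nonneg (n : ℕ) (x : Rn n) : 0 ≤ besselKernel n x :=
  mul_nonneg (by positivity) (besselK_nonneg _ _)

theorem measurable_besselK (ν : ℝ) : Measurable (besselK ν) := by
  have h : StronglyMeasurable (Function.uncurry fun r s : ℝ =>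
      Real.exp (-r * Real.cosh s) * Real.cosh (ν * s)) :=
    (by unfold Function.uncurry; fun_prop : Continuous _).stronglyMeasurable
  exact (h.integral_prod_right (ν := volume.restrict (Ioi (0 : ℝ)))).measurable

theorem measurable_besselKernel (n : ℕ) : Measurable (besselKernel n) := by
  unfold besselKernel
  exact (measurable_const.mul (measurable_norm.pow_const _)).mul
    ((measurable_besselK _).comp measurable_norm)

/-- No integrability is needed: otherwise the Bochner integral is `0`. -/
theorem ofReal_integral_le_lintegral {α : Type*} [MeasurableSpace α] {μ : Measure α} {f : α → ℝ}
    (hf : 0 ≤ f) : ENNReal.ofReal (∫ x, f x ∂μ) ≤ ∫⁻ x, ENNReal.ofReal (f x) ∂μ := by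
  by_cases h : Integrable f μ
  · exact (ofReal_integral_eq_lintegral_ofReal h (ae_of_all _ hf)).le
  · simp [integral_undef h]

/-- The radial integral `∫ |x|^(1-n/2) e^{-λ|x|} dx` scales like `λ^{-(n/2+1)}`. -/
theorem exists_lintegral_radial_le (n : ℕ) (hn : 1 ≤ n) : ∃ C : ℝ, 0 ≤ C ∧ ∀ l : ℝ, 0 < l →
    ∫⁻ x : Rn n, ENNReal.ofReal (‖x‖ ^ (1 - (n : ℝ) / 2) * Real.exp (-(l * ‖x‖))) ≤
      ENNReal.ofReal (C * (1 / l) ^ ((n : ℝ) / 2 + 1)) := by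
  have : Nonempty (Fin n) := ⟨⟨0, hn⟩⟩
  have : Nontrivial (Rn n) := inferInstance
  refine ⟨n * (volume : Measure (Rn n)).real (Metric.ball 0 1) * Real.Gamma ((n : ℝ) / 2 + 1),
    by positivity, fun l hl => ?_⟩
  set f : ℝ → ℝ := fun r => r ^ (1 - (n : ℝ) / 2) * Real.exp (-(l * r)) with hf
  have hpow : ∀ y ∈ Ioi (0 : ℝ), y ^ (n - 1) • f y =
      y ^ ((n : ℝ) / 2 + 1 - 1) * Real.exp (-(l * y)) := by
    intro y hy
    simp only [hf, smul_eq_mul, ← mul_assoc]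
    rw [← Real.rpow_natCast, ← Real.rpow_add hy, Nat.cast_sub hn]
    congr 2
    push_cast
    ring
  have hint : Integrable (fun x : Rn n => f ‖x‖) := by
    rw [integrable_fun_norm_addHaar, finrank_euclideanSpace_fin,
      integrableOn_congr_fun hpow measurableSet_Ioi]
    have := integrableOn_rpow_mul_exp_neg_mul_rpow (s := (n : ℝ) / 2 + 1 - 1) (p := 1) (b := l)
      (by have : (0 : ℝ) ≤ n := n.cast_nonneg
          linarith) one_pos hl
    simpa [neg_mul] using this
  rw [← ofReal_integral_eq_lintegral_ofReal hint (ae_of_all _ fun x => by positivity),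
    integral_fun_norm_addHaar volume f, finrank_euclideanSpace_fin,
    setIntegral_congr_fun measurableSet_Ioi hpow,
    Real.integral_rpow_mul_exp_neg_mul_Ioi (by positivity) hl]
  refine ENNReal.ofReal_le_ofReal (le_of_eq ?_)
  simp only [nsmul_eq_mul, smul_eq_mul]
  ring

/-- The exponential moment `∫ B(z) e^{ρ|z|} dz` of the Bessel kernel. -/
def besselMoment (n : ℕ) (ρ : ℝ) : ENNReal :=
  ∫⁻ z : Rn n, ENNReal.ofReal (besselKernel n z) * ENNReal.ofReal (Real.exp (ρ * ‖z‖))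

/-- In `B(z) e^{ρ|z|}` the factor `exp(-|z| cosh s)` of the integral representation of `K_ν` becomes
`exp(-|z| (cosh s - ρ))`; after the integration in `z` there remains a function of `s` which is
`O(e^{-s})` because `|n/2 - 1| ≤ n/2`. -/
theorem besselMoment_lt_top {n : ℕ} (hn : 1 ≤ n) {ρ : ℝ} (h0 : 0 ≤ ρ) (h1 : ρ < 1) :
    besselMoment n ρ < ⊤ := by
  obtain ⟨C, hC, hrad⟩ := exists_lintegral_radial_le n hn
  set c : ℝ := (2 * Real.pi) ^ (-(n : ℝ) / 2) with hc
  have hc0 : 0 ≤ c := by positivity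
  set ν : ℝ := (n : ℝ) / 2 - 1 with hν
  have hn' : (1 : ℝ) ≤ n := by exact_mod_cast hn
  set F : Rn n → ℝ → ENNReal := fun z s => ENNReal.ofReal
    (c * Real.cosh (ν * s) *
      (‖z‖ ^ (1 - (n : ℝ) / 2) * Real.exp (-((Real.cosh s - ρ) * ‖z‖)))) with hF
  have hFm : Measurable (Function.uncurry F) := by
    unfold Function.uncurry
    simp only [hF]
    refine ENNReal.measurable_ofReal.comp (Measurable.mul ?_ (Measurable.mul ?_ ?_))
    · exact (by fun_prop : Continuous fun p : Rn n × ℝ => c * Real.cosh (ν * p.2)).measurable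
    · exact (measurable_norm.comp measurable_fst).pow_const _
    · exact (by fun_prop : Continuous fun p : Rn n × ℝ =>
        Real.exp (-((Real.cosh p.2 - ρ) * ‖p.1‖))).measurable
  calc besselMoment n ρ ≤ ∫⁻ z, ∫⁻ s in Ioi (0 : ℝ), F z s := by
        refine lintegral_mono fun z => ?_
        rw [← ENNReal.ofReal_mul (besselKernel_nonneg n z)]
        have : besselKernel n z * Real.exp (ρ * ‖z‖) = ∫ s in Ioi (0 : ℝ),
            c * Real.cosh (ν * s) *
              (‖z‖ ^ (1 - (n : ℝ) / 2) * Real.exp (-((Real.cosh s - ρ) * ‖z‖))) := by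
          rw [besselKernel, besselK, mul_right_comm, ← integral_const_mul]
          refine integral_congr_ae (ae_of_all _ fun s => ?_)
          have : Real.exp (-((Real.cosh s - ρ) * ‖z‖)) =
              Real.exp (ρ * ‖z‖) * Real.exp (-‖z‖ * Real.cosh s) := by
            rw [← Real.exp_add]; ring_nf
          simp only [this]
          ring
        rw [this]
        exact ofReal_integral_le_lintegral fun s =>
          mul_nonneg (mul_nonneg hc0 (Real.cosh_pos _).le) (by positivity)
    _ = ∫⁻ s in Ioi (0 : ℝ), ∫⁻ z, F z s := lintegral_lintegral_swap hFm.aemeasurable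
    _ ≤ ∫⁻ s in Ioi (0 : ℝ),
          ENNReal.ofReal (c * C * (2 / (1 - ρ)) ^ ((n : ℝ) / 2 + 1) * Real.exp (-s)) := by
        refine setLIntegral_mono' measurableSet_Ioi fun s hs => ?_
        have hs : 0 < s := hs
        have hcosh : Real.exp s / 2 ≤ Real.cosh s := by
          rw [Real.cosh_eq]; linarith [Real.exp_pos (-s)]
        have hl' : (1 - ρ) / 2 * Real.exp s ≤ Real.cosh s - ρ := by
          nlinarith [Real.one_le_cosh s]
        have hρ : 0 < 1 - ρ := by linarith
        have hl : 0 < Real.cosh s - ρ := lt_of_lt_of_le (by positivity) hl'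
        simp only [hF]
        simp_rw [ENNReal.ofReal_mul (mul_nonneg hc0 (Real.cosh_pos (ν * s)).le)]
        rw [lintegral_const_mul']
        swap
        · exact ENNReal.ofReal_ne_top
        refine (mul_le_mul_right (hrad _ hl) _).trans ?_
        rw [← ENNReal.ofReal_mul (mul_nonneg hc0 (Real.cosh_pos (ν * s)).le)]
        refine ENNReal.ofReal_le_ofReal ?_
        have e1 : Real.cosh (ν * s) ≤ Real.exp ((n : ℝ) / 2 * s) := by
          rw [Real.cosh_eq]
          have a1 : Real.exp (ν * s) ≤ Real.exp ((n : ℝ) / 2 * s) :=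
            Real.exp_le_exp.2 (by rw [hν]; nlinarith)
          have a2 : Real.exp (-(ν * s)) ≤ Real.exp ((n : ℝ) / 2 * s) :=
            Real.exp_le_exp.2 (by rw [hν]; nlinarith)
          linarith
        have e2 : (1 / (Real.cosh s - ρ)) ^ ((n : ℝ) / 2 + 1) ≤
            (2 / (1 - ρ)) ^ ((n : ℝ) / 2 + 1) * Real.exp (-((n : ℝ) / 2 + 1) * s) := by
          have : (1 / (Real.cosh s - ρ)) ≤ 2 / (1 - ρ) * Real.exp (-s) := by
            rw [Real.exp_neg, div_le_iff₀ hl]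
            calc (1 : ℝ) = 2 / (1 - ρ) * (Real.exp s)⁻¹ * ((1 - ρ) / 2 * Real.exp s) := by
                  field_simp
              _ ≤ _ := by gcongr
          refine (Real.rpow_le_rpow (by positivity) this (by positivity)).trans (le_of_eq ?_)
          rw [Real.mul_rpow (by positivity) (by positivity), ← Real.exp_mul]
          ring_nf
        calc c * Real.cosh (ν * s) * (C * (1 / (Real.cosh s - ρ)) ^ ((n : ℝ) / 2 + 1))
            ≤ c * Real.exp ((n : ℝ) / 2 * s) * (C * ((2 / (1 - ρ)) ^ ((n : ℝ) / 2 + 1) *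
              Real.exp (-((n : ℝ) / 2 + 1) * s))) := by gcongr
          _ = c * C * (2 / (1 - ρ)) ^ ((n : ℝ) / 2 + 1) *
              (Real.exp ((n : ℝ) / 2 * s) * Real.exp (-((n : ℝ) / 2 + 1) * s)) := by ring
          _ = _ := by rw [← Real.exp_add]; ring_nf
    _ < ⊤ := by
        have hi : IntegrableOn (fun s => c * C * (2 / (1 - ρ)) ^ ((n : ℝ) / 2 + 1) *
            Real.exp (-s)) (Ioi (0 : ℝ)) := (integrableOn_exp_neg_Ioi 0).const_mul _
        refine lt_of_le_of_lt (lintegral_mono fun s => ?_) hi.2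
        exact Real.ofReal_le_enorm _

/-! ### The positive majorant of the integral operator -/

/-- The norm of `L¹(ℝⁿ, e^{-ρ|x|} dx)` for functions with values in `[0,∞]`. -/
def expLNorm {n : ℕ} (ρ : ℝ) (w : Rn n → ENNReal) : ENNReal :=
  ∫⁻ x, ENNReal.ofReal (Real.exp (-ρ * ‖x‖)) * w x

theorem measurable_expWeight {n : ℕ} (ρ : ℝ) :
    Measurable fun x : Rn n => ENNReal.ofReal (Real.exp (-ρ * ‖x‖)) := by fun_prop

theorem expLNorm_mono {n : ℕ} (ρ : ℝ) {w w' : Rn n → ENNReal} (h : ∀ᵐ x, w x ≤ w' x) :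
    expLNorm ρ w ≤ expLNorm ρ w' :=
  lintegral_mono_ae (h.mono fun _ hx => mul_le_mul_right hx _)

theorem expLNorm_anti {n : ℕ} {ρ ρ' : ℝ} (h : ρ ≤ ρ') (w : Rn n → ENNReal) :
    expLNorm ρ' w ≤ expLNorm ρ w := by
  refine lintegral_mono fun x => mul_le_mul_left (ENNReal.ofReal_le_ofReal ?_) _
  have := norm_nonneg x
  gcongr

/-- For a set `A` of times, `∫_A ∫ |B(x - y) V(y,τ)| w(y,τ) dy dτ`, as a number in `[0,∞]`. -/
def majorantOn {n : ℕ} (V : Rn n → ℝ → ℝ) (w : ℝ → Rn n → ENNReal) (A : Set ℝ) (x : Rn n) :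
    ENNReal :=
  ∫⁻ τ in A, ∫⁻ y, ‖besselKernel n (x - y) * V y τ‖ₑ * w τ y

/-- The positive operator dominating `𝓑̂V(t)`. -/
def majorant {n : ℕ} (V : Rn n → ℝ → ℝ) (w : ℝ → Rn n → ENNReal) (t : ℝ) (x : Rn n) : ENNReal :=
  majorantOn V w (Ioc 0 t) x

/-- A jointly measurable potential with `|V(y,τ)| ≤ C_T (1 + |y|^σ)` for all `y` and all
`τ ∈ (0,T]`, `T` being arbitrary. -/
structure GrowthBound {n : ℕ} (V : Rn n → ℝ → ℝ) (σ : ℝ) : Prop where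
  measurable : Measurable (Function.uncurry V)
  bound : ∀ T : ℝ, ∃ C : ℝ, 0 ≤ C ∧ ∀ τ ∈ Ioc 0 T, ∀ y, |V y τ| ≤ C * (1 + ‖y‖ ^ σ)

theorem measurable_majorant_integrand {n : ℕ} {V : Rn n → ℝ → ℝ} (hV : Measurable (Function.uncurry V))
    {w : ℝ → Rn n → ENNReal} (hw : Measurable (Function.uncurry w)) :
    Measurable fun p : (Rn n × ℝ) × Rn n =>
      ‖besselKernel n (p.1.1 - p.2) * V p.2 p.1.2‖ₑ * w p.1.2 p.2 := by
  refine Measurable.mul (Measurable.enorm (Measurable.mul ?_ ?_)) ?_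
  · exact (measurable_besselKernel n).comp (by fun_prop)
  · exact hV.comp (measurable_snd.prodMk (measurable_snd.comp measurable_fst))
  · exact hw.comp ((measurable_snd.comp measurable_fst).prodMk measurable_snd)

theorem measurable_majorant_inner {n : ℕ} {V : Rn n → ℝ → ℝ} (hV : Measurable (Function.uncurry V))
    {w : ℝ → Rn n → ENNReal} (hw : Measurable (Function.uncurry w)) :
    Measurable fun p : Rn n × ℝ =>
      ∫⁻ y, ‖besselKernel n (p.1 - y) * V y p.2‖ₑ * w p.2 y :=
  (measurable_majorant_integrand hV hw).lintegral_prod_right'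

theorem measurable_majorant {n : ℕ} {V : Rn n → ℝ → ℝ} (hV : Measurable (Function.uncurry V))
    {w : ℝ → Rn n → ENNReal} (hw : Measurable (Function.uncurry w)) :
    Measurable (Function.uncurry (majorant V w)) := by
  set f : (ℝ × Rn n) × ℝ → ENNReal := {q | q.2 ∈ Ioc 0 q.1.1}.indicator
    (fun q => ∫⁻ y, ‖besselKernel n (q.1.2 - y) * V y q.2‖ₑ * w q.2 y) with hf
  have hfm : Measurable f := by
    refine Measurable.indicator ?_ ?_
    · have hg : Measurable fun q : (ℝ × Rn n) × ℝ => (q.1.2, q.2) := by fun_prop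
      have := (measurable_majorant_inner hV hw).comp hg
      simpa only [Function.comp_def] using this
    · have h1 : MeasurableSet {q : (ℝ × Rn n) × ℝ | 0 < q.2} :=
        measurableSet_lt measurable_const measurable_snd
      have h2 : MeasurableSet {q : (ℝ × Rn n) × ℝ | q.2 ≤ q.1.1} :=
        measurableSet_le measurable_snd (by fun_prop)
      exact h1.inter h2
  have h : Function.uncurry (majorant V w) = fun p : ℝ × Rn n => ∫⁻ τ, f (p, τ) := by
    ext p
    simp only [Function.uncurry, majorant, majorantOn]
    rw [← lintegral_indicator measurableSet_Ioc]
    rfl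
  rw [h]
  exact hfm.lintegral_prod_right'

theorem measurable_majorant_iterate {n : ℕ} {V : Rn n → ℝ → ℝ}
    (hV : Measurable (Function.uncurry V)) {w : ℝ → Rn n → ENNReal}
    (hw : Measurable (Function.uncurry w)) (k : ℕ) :
    Measurable (Function.uncurry ((majorant V)^[k] w)) := by
  induction k with
  | zero => exact hw
  | succ k ih =>
    rw [Function.iterate_succ_apply']
    exact measurable_majorant hV ih

theorem majorant_mono_time {n : ℕ} (V : Rn n → ℝ → ℝ) (w : ℝ → Rn n → ENNReal) {s t : ℝ}
    (h : s ≤ t) (x : Rn n) : majorant V w s x ≤ majorant V w t x :=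
  lintegral_mono_set (Ioc_subset_Ioc_right h)

theorem majorant_mono {n : ℕ} (V : Rn n → ℝ → ℝ) {w w' : ℝ → Rn n → ENNReal} {t : ℝ}
    (h : ∀ τ ∈ Ioc 0 t, ∀ᵐ y, w τ y ≤ w' τ y) (x : Rn n) :
    majorant V w t x ≤ majorant V w' t x :=
  setLIntegral_mono' measurableSet_Ioc fun τ hτ =>
    lintegral_mono_ae ((h τ hτ).mono fun _ hy => mul_le_mul_right hy _)

/-! ### Weighted estimates -/

/-- Young's inequality for the weight `e^{-ρ|x|}`: it rests on `|y| ≤ |x| + |x - y|`. -/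
theorem expLNorm_conv_le {n : ℕ} {ρ : ℝ} (hρ : 0 ≤ ρ) {g : Rn n → ENNReal} (hg : Measurable g) :
    expLNorm ρ (fun x => ∫⁻ y, ENNReal.ofReal (besselKernel n (x - y)) * g y) ≤
      besselMoment n ρ * expLNorm ρ g := by
  have hB : Measurable fun p : Rn n × Rn n => ENNReal.ofReal (besselKernel n (p.1 - p.2)) :=
    ENNReal.measurable_ofReal.comp ((measurable_besselKernel n).comp (by fun_prop))
  have hW := measurable_expWeight (n := n) ρ
  calc expLNorm ρ (fun x => ∫⁻ y, ENNReal.ofReal (besselKernel n (x - y)) * g y)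
      = ∫⁻ x, ∫⁻ y, ENNReal.ofReal (Real.exp (-ρ * ‖x‖)) *
          (ENNReal.ofReal (besselKernel n (x - y)) * g y) := by
        refine lintegral_congr fun x => ?_
        rw [lintegral_const_mul' _ _ ENNReal.ofReal_ne_top]
    _ = ∫⁻ y, ∫⁻ x, ENNReal.ofReal (Real.exp (-ρ * ‖x‖)) *
          (ENNReal.ofReal (besselKernel n (x - y)) * g y) :=
        lintegral_lintegral_swap ((hW.comp measurable_fst).mul
          (hB.mul (hg.comp measurable_snd))).aemeasurable
    _ ≤ ∫⁻ y, ∫⁻ x, (ENNReal.ofReal (Real.exp (-ρ * ‖y‖)) * g y) *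
          (ENNReal.ofReal (besselKernel n (x - y)) *
            ENNReal.ofReal (Real.exp (ρ * ‖x - y‖))) := by
        refine lintegral_mono fun y => lintegral_mono fun x => ?_
        have : ENNReal.ofReal (Real.exp (-ρ * ‖x‖)) ≤
            ENNReal.ofReal (Real.exp (-ρ * ‖y‖)) * ENNReal.ofReal (Real.exp (ρ * ‖x - y‖)) := by
          rw [← ENNReal.ofReal_mul (Real.exp_pos _).le, ← Real.exp_add]
          refine ENNReal.ofReal_le_ofReal (Real.exp_le_exp.2 ?_)
          have : ‖y‖ - ‖x‖ ≤ ‖x - y‖ := by rw [norm_sub_rev]; exact norm_sub_norm_le y x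
          nlinarith
        calc _ ≤ ENNReal.ofReal (Real.exp (-ρ * ‖y‖)) * ENNReal.ofReal (Real.exp (ρ * ‖x - y‖)) *
              (ENNReal.ofReal (besselKernel n (x - y)) * g y) := by gcongr
          _ = _ := by ring
    _ = ∫⁻ y, (ENNReal.ofReal (Real.exp (-ρ * ‖y‖)) * g y) * besselMoment n ρ := by
        refine lintegral_congr fun y => ?_
        have hm : Measurable fun z : Rn n => ENNReal.ofReal (besselKernel n z) *
            ENNReal.ofReal (Real.exp (ρ * ‖z‖)) :=
          (ENNReal.measurable_ofReal.comp (measurable_besselKernel n)).mul (by fun_prop)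
        have hm' : Measurable fun x : Rn n => ENNReal.ofReal (besselKernel n (x - y)) *
            ENNReal.ofReal (Real.exp (ρ * ‖x - y‖)) := hm.comp (measurable_id.sub_const y)
        rw [lintegral_const_mul _ hm']
        congr 1
        exact lintegral_sub_right_eq_self
          (fun z => ENNReal.ofReal (besselKernel n z) * ENNReal.ofReal (Real.exp (ρ * ‖z‖))) y
    _ = _ := by
        have hWg : Measurable fun y : Rn n => ENNReal.ofReal (Real.exp (-ρ * ‖y‖)) * g y :=
          hW.mul hg
        rw [lintegral_mul_const _ hWg, mul_comm]
        rfl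

/-- A loss `δ` in the exponential weight absorbs the growth `|y|^σ`, at the price `δ^{-σ}`. -/
theorem one_add_rpow_mul_exp_le {σ δ r : ℝ} (hσ0 : 0 ≤ σ) (hσ1 : σ ≤ 1) (hδ0 : 0 < δ) (hδ1 : δ ≤ 1)
    (hr : 0 ≤ r) : (1 + r ^ σ) * Real.exp (-δ * r) ≤ 2 * δ ^ (-σ) := by
  have h1 : 1 ≤ δ ^ (-σ) := by
    rw [Real.rpow_neg hδ0.le]
    exact (one_le_inv₀ (by positivity)).2 (Real.rpow_le_one hδ0.le hδ1 hσ0)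
  have h2 : (δ * r) ^ σ ≤ Real.exp (δ * r) := by
    have hs : 0 ≤ δ * r := by positivity
    calc (δ * r) ^ σ ≤ (1 + δ * r) ^ σ := Real.rpow_le_rpow hs (by linarith) hσ0
      _ ≤ (1 + δ * r) ^ (1 : ℝ) := Real.rpow_le_rpow_of_exponent_le (by linarith) hσ1
      _ ≤ _ := by rw [Real.rpow_one]; linarith [Real.add_one_le_exp (δ * r)]
  have h3 : r ^ σ = δ ^ (-σ) * (δ * r) ^ σ := by
    rw [Real.mul_rpow hδ0.le hr, ← mul_assoc, ← Real.rpow_add hδ0]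
    simp
  have h4 : r ^ σ * Real.exp (-δ * r) ≤ δ ^ (-σ) := by
    rw [h3, mul_assoc]
    refine mul_le_of_le_one_right (by positivity) ?_
    rw [neg_mul, Real.exp_neg, ← div_eq_mul_inv]
    exact (div_le_one (Real.exp_pos _)).2 h2
  have h5 : Real.exp (-δ * r) ≤ 1 := Real.exp_le_one_iff.2 (by nlinarith)
  nlinarith

/-- The basic estimate: the majorant operator maps `𝓔_ρ` to `𝓔_{ρ+δ}` with norm `O(δ^{-σ})`. -/
theorem expLNorm_majorantOn_le {n : ℕ} {V : Rn n → ℝ → ℝ} (hVm : Measurable (Function.uncurry V))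
    {C σ T : ℝ} (hC : 0 ≤ C) (hV : ∀ τ ∈ Ioc 0 T, ∀ y, |V y τ| ≤ C * (1 + ‖y‖ ^ σ))
    (hσ0 : 0 ≤ σ) (hσ1 : σ ≤ 1) {ρ δ ρ₁ : ℝ} (hρ : 0 ≤ ρ) (hδ0 : 0 < δ) (hδ1 : δ ≤ 1)
    (hρ₁ : ρ + δ ≤ ρ₁) {w : ℝ → Rn n → ENNReal} (hw : Measurable (Function.uncurry w))
    {A : Set ℝ} (hA : MeasurableSet A) (hAT : A ⊆ Ioc 0 T) :
    expLNorm (ρ + δ) (majorantOn V w A) ≤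
      ∫⁻ τ in A, besselMoment n ρ₁ * ENNReal.ofReal (C * (2 * δ ^ (-σ))) * expLNorm ρ (w τ) := by
  have hW := measurable_expWeight (n := n) (ρ + δ)
  have hI := measurable_majorant_inner hVm hw
  calc expLNorm (ρ + δ) (majorantOn V w A)
      = ∫⁻ x, ∫⁻ τ in A, ENNReal.ofReal (Real.exp (-(ρ + δ) * ‖x‖)) *
          ∫⁻ y, ‖besselKernel n (x - y) * V y τ‖ₑ * w τ y := by
        refine lintegral_congr fun x => ?_
        rw [lintegral_const_mul' _ _ ENNReal.ofReal_ne_top]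
        rfl
    _ = ∫⁻ τ in A, ∫⁻ x, ENNReal.ofReal (Real.exp (-(ρ + δ) * ‖x‖)) *
          ∫⁻ y, ‖besselKernel n (x - y) * V y τ‖ₑ * w τ y :=
        lintegral_lintegral_swap ((hW.comp measurable_fst).mul hI).aemeasurable
    _ ≤ _ := by
        refine setLIntegral_mono' hA fun τ hτ => ?_
        have hVτ : Measurable fun y => V y τ := hVm.comp (measurable_id.prodMk measurable_const)
        have hwτ : Measurable (w τ) := hw.comp (measurable_const.prodMk measurable_id)
        have e1 : ∀ x y, ‖besselKernel n (x - y) * V y τ‖ₑ * w τ y =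
            ENNReal.ofReal (besselKernel n (x - y)) * (‖V y τ‖ₑ * w τ y) := by
          intro x y
          rw [enorm_mul, Real.enorm_of_nonneg (besselKernel_nonneg _ _), mul_assoc]
        simp_rw [e1]
        refine (expLNorm_conv_le (by linarith) (hVτ.enorm.mul hwτ)).trans ?_
        rw [mul_assoc]
        refine mul_le_mul' ?_ ?_
        · refine lintegral_mono fun z => mul_le_mul_right (ENNReal.ofReal_le_ofReal ?_) _
          have := norm_nonneg z
          gcongr
        · rw [expLNorm, expLNorm, ← lintegral_const_mul' _ _ ENNReal.ofReal_ne_top]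
          refine lintegral_mono fun y => ?_
          simp only [Pi.mul_apply]
          rw [← mul_assoc, ← mul_assoc, Real.enorm_eq_ofReal_abs]
          refine mul_le_mul_left ?_ _
          rw [← ENNReal.ofReal_mul (Real.exp_pos _).le, ← ENNReal.ofReal_mul (by positivity)]
          refine ENNReal.ofReal_le_ofReal ?_
          have hy := one_add_rpow_mul_exp_le hσ0 hσ1 hδ0 hδ1 (norm_nonneg y)
          have : Real.exp (-(ρ + δ) * ‖y‖) = Real.exp (-δ * ‖y‖) * Real.exp (-ρ * ‖y‖) := by
            rw [← Real.exp_add]; ring_nf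
          rw [this]
          calc _ ≤ Real.exp (-δ * ‖y‖) * Real.exp (-ρ * ‖y‖) * (C * (1 + ‖y‖ ^ σ)) := by
                gcongr; exact hV τ (hAT hτ) y
            _ = C * ((1 + ‖y‖ ^ σ) * Real.exp (-δ * ‖y‖)) * Real.exp (-ρ * ‖y‖) := by ring
            _ ≤ _ := by gcongr

theorem lintegral_Ioc_pow_div_factorial {K t : ℝ} (hK : 0 ≤ K) (ht : 0 ≤ t) (j : ℕ) :
    ∫⁻ τ in Ioc 0 t, ENNReal.ofReal (K * ((K * τ) ^ j / j.factorial)) =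
      ENNReal.ofReal ((K * t) ^ (j + 1) / (j + 1).factorial) := by
  rw [← ofReal_integral_eq_lintegral_ofReal]
  · rw [← intervalIntegral.integral_of_le ht]
    congr 1
    have : (fun τ : ℝ => K * ((K * τ) ^ j / j.factorial)) =
        fun τ => (K ^ (j + 1) / j.factorial) * τ ^ j := by
      ext τ; ring
    rw [this, intervalIntegral.integral_const_mul, integral_pow, Nat.factorial_succ]
    push_cast
    field_simp
    simp [mul_pow]
  · exact (by fun_prop : Continuous fun τ : ℝ => K * ((K * τ) ^ j / j.factorial)).integrableOn_Ioc
  · refine (ae_restrict_iff' measurableSet_Ioc).2 (ae_of_all _ fun τ hτ => ?_)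
    have := hτ.1.le
    simp only [Pi.zero_apply]
    positivity

/-- `j` applications of the majorant operator, each with the loss `δ` in the weight. -/
theorem expLNorm_majorant_iterate_le {n : ℕ} (hn : 1 ≤ n) {V : Rn n → ℝ → ℝ}
    (hVm : Measurable (Function.uncurry V))
    {C σ T : ℝ} (hC : 0 ≤ C) (hV : ∀ τ ∈ Ioc 0 T, ∀ y, |V y τ| ≤ C * (1 + ‖y‖ ^ σ))
    (hσ0 : 0 ≤ σ) (hσ1 : σ ≤ 1) {ρ δ ρ₁ : ℝ} (hρ : 0 ≤ ρ) (hδ0 : 0 < δ) (hδ1 : δ ≤ 1)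
    (hρ₁ : ρ₁ < 1) {w : ℝ → Rn n → ENNReal} (hw : Measurable (Function.uncurry w))
    {m : ENNReal} (hm : ∀ t ∈ Icc 0 T, expLNorm ρ (w t) ≤ m) (j : ℕ) (hj : ρ + j * δ ≤ ρ₁) :
    ∀ t ∈ Icc 0 T, expLNorm (ρ + j * δ) ((majorant V)^[j] w t) ≤
      m * ENNReal.ofReal
        (((besselMoment n ρ₁).toReal * (C * (2 * δ ^ (-σ))) * t) ^ j / j.factorial) := by
  induction j with
  | zero => simpa using hm
  | succ j ih =>
    intro t ht
    have hρ₁0 : 0 ≤ ρ₁ := le_trans (by positivity) hj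
    have hj' : ρ + j * δ + δ ≤ ρ₁ := by push_cast at hj; linarith
    set K : ℝ := (besselMoment n ρ₁).toReal * (C * (2 * δ ^ (-σ))) with hKdef
    have hK : 0 ≤ K := by positivity
    have hKe : besselMoment n ρ₁ * ENNReal.ofReal (C * (2 * δ ^ (-σ))) = ENNReal.ofReal K := by
      rw [hKdef, ENNReal.ofReal_mul ENNReal.toReal_nonneg,
        ENNReal.ofReal_toReal (besselMoment_lt_top hn hρ₁0 hρ₁).ne]
    rw [Function.iterate_succ_apply']
    have e : ρ + ((j + 1 : ℕ) : ℝ) * δ = ρ + j * δ + δ := by push_cast; ring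
    rw [e]
    refine (expLNorm_majorantOn_le hVm hC hV hσ0 hσ1 (by positivity) hδ0 hδ1 hj'
      (measurable_majorant_iterate hVm hw j) measurableSet_Ioc (Ioc_subset_Ioc_right ht.2)).trans ?_
    rw [hKe, ← lintegral_Ioc_pow_div_factorial hK ht.1 j, ← lintegral_const_mul _ (by fun_prop)]
    refine setLIntegral_mono' measurableSet_Ioc fun τ hτ => ?_
    have hτT : τ ∈ Icc 0 T := ⟨hτ.1.le, hτ.2.trans ht.2⟩
    refine (mul_le_mul_right (ih (by linarith) τ hτT) _).trans (le_of_eq ?_)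
    rw [ENNReal.ofReal_mul hK]
    ring

/-- The `k`-th Picard bound with the loss `δ = η/k` per step is summable since `σ < 1`. -/
theorem summable_rpow_pow_div_factorial {σ D : ℝ} (hσ0 : 0 ≤ σ) (hσ1 : σ < 1) (hD : 0 ≤ D) :
    Summable fun k : ℕ => (D * (k : ℝ) ^ σ) ^ k / k.factorial := by
  set X : ℝ := D * Real.exp σ with hX
  have hX0 : 0 ≤ X := by positivity
  have hs : Summable fun k : ℕ => (X + 1) ^ k * (k.factorial : ℝ) ^ (σ - 1) := by
    refine summable_of_ratio_test_tendsto_lt_one (l := 0) one_pos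
      (Eventually.of_forall fun k => by positivity) ?_
    have : ∀ k : ℕ, ‖(X + 1) ^ (k + 1) * ((k + 1).factorial : ℝ) ^ (σ - 1)‖ /
        ‖(X + 1) ^ k * (k.factorial : ℝ) ^ (σ - 1)‖ =
        (X + 1) * ((k : ℝ) + 1) ^ (-(1 - σ)) := by
      intro k
      rw [Real.norm_of_nonneg (by positivity), Real.norm_of_nonneg (by positivity),
        Nat.factorial_succ]
      push_cast
      rw [Real.mul_rpow (by positivity) (by positivity), neg_sub]
      field_simp
      ring
    simp_rw [this]
    rw [← mul_zero (X + 1)]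
    refine Tendsto.const_mul _ ?_
    exact (tendsto_rpow_neg_atTop (by linarith)).comp
      (tendsto_atTop_add_const_right _ _ tendsto_natCast_atTop_atTop)
  refine Summable.of_nonneg_of_le (fun k => by positivity) (fun k => ?_) hs
  -- `k ^ k ≤ e ^ k k!` turns `k ^ (σ k) / k!` into `e ^ (σ k) (k!) ^ (σ - 1)`.
  have hk : (k : ℝ) ^ k ≤ Real.exp k * k.factorial := by
    have := Real.pow_div_factorial_le_exp (k : ℝ) k.cast_nonneg k
    rwa [div_le_iff₀ (by positivity)] at this
  have h1 : ((k : ℝ) ^ σ) ^ k ≤ Real.exp σ ^ k * (k.factorial : ℝ) ^ σ := by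
    calc ((k : ℝ) ^ σ) ^ k = ((k : ℝ) ^ k) ^ σ := by
          rw [← Real.rpow_natCast, ← Real.rpow_mul k.cast_nonneg, mul_comm,
            Real.rpow_mul k.cast_nonneg, Real.rpow_natCast]
      _ ≤ (Real.exp k * k.factorial) ^ σ := Real.rpow_le_rpow (by positivity) hk hσ0
      _ = _ := by
          rw [Real.mul_rpow (by positivity) (by positivity), ← Real.exp_mul, ← Real.exp_nat_mul]
  calc (D * (k : ℝ) ^ σ) ^ k / k.factorial
      ≤ D ^ k * (Real.exp σ ^ k * (k.factorial : ℝ) ^ σ) / k.factorial := by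
        rw [mul_pow]; gcongr
    _ = X ^ k * (k.factorial : ℝ) ^ (σ - 1) := by
        rw [Real.rpow_sub_one (by positivity), hX, mul_pow]; ring
    _ ≤ _ := by gcongr; linarith

/-- The iterates of the majorant operator are summable from `𝓔_{ρ₀}` to `𝓔_{ρ₁}`, `ρ₀ < ρ₁ < 1`,
uniformly on bounded time intervals: the `k`-th iterate loses `(ρ₁ - ρ₀)/k` in each of its
`k` steps. -/
theorem exists_summable_bound {n : ℕ} (hn : 1 ≤ n) {V : Rn n → ℝ → ℝ} {σ : ℝ}
    (hV : GrowthBound V σ) (hσ0 : 0 ≤ σ) (hσ1 : σ < 1) {ρ₀ ρ₁ : ℝ} (h0 : 0 ≤ ρ₀) (h01 : ρ₀ < ρ₁)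
    (h1 : ρ₁ < 1) {T : ℝ} (hT : 0 ≤ T) : ∃ b : ℕ → ℝ, (∀ k, 0 ≤ b k) ∧ Summable b ∧
      ∀ (w : ℝ → Rn n → ENNReal) (m : ENNReal), Measurable (Function.uncurry w) →
        (∀ t ∈ Icc 0 T, expLNorm ρ₀ (w t) ≤ m) →
        ∀ k, ∀ t ∈ Icc 0 T, expLNorm ρ₁ ((majorant V)^[k] w t) ≤ m * ENNReal.ofReal (b k) := by
  obtain ⟨C, hC, hCV⟩ := hV.bound T
  set η := ρ₁ - ρ₀ with hη
  have hη0 : 0 < η := by linarith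
  set D : ℝ := (besselMoment n ρ₁).toReal * (C * (2 * η ^ (-σ))) * T with hD
  have hD0 : 0 ≤ D := by positivity
  refine ⟨fun k => (D * (k : ℝ) ^ σ) ^ k / k.factorial, fun k => by positivity,
    summable_rpow_pow_div_factorial hσ0 hσ1 hD0, fun w m hw hm k t ht => ?_⟩
  rcases Nat.eq_zero_or_pos k with rfl | hk
  · simpa using (expLNorm_anti h01.le _).trans (hm t ht)
  have hk0 : (0 : ℝ) < k := by exact_mod_cast hk
  have hk1 : (1 : ℝ) ≤ k := by exact_mod_cast hk
  have hsum : ρ₀ + k * (η / k) = ρ₁ := by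
    field_simp
    linarith
  have key := expLNorm_majorant_iterate_le hn hV.measurable hC hCV hσ0 hσ1.le h0
    (δ := η / k) (by positivity) ((div_le_one hk0).2 (by linarith)) h1 hw hm k hsum.le t ht
  rw [hsum] at key
  refine key.trans (mul_le_mul_right (ENNReal.ofReal_le_ofReal ?_) _)
  have ht0 := ht.1
  -- The constant of one step with the loss `η / k` is of order `k ^ σ`.
  have e : (η / k) ^ (-σ) = η ^ (-σ) * (k : ℝ) ^ σ := by
    rw [Real.div_rpow hη0.le hk0.le, Real.rpow_neg hk0.le, div_inv_eq_mul]
  rw [e]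
  have : (besselMoment n ρ₁).toReal * (C * (2 * (η ^ (-σ) * (k : ℝ) ^ σ))) * t ≤
      D * (k : ℝ) ^ σ := by
    calc _ ≤ (besselMoment n ρ₁).toReal * (C * (2 * (η ^ (-σ) * (k : ℝ) ^ σ))) * T := by
          gcongr; exact ht.2
      _ = _ := by rw [hD]; ring
  have h0 : 0 ≤ (besselMoment n ρ₁).toReal * (C * (2 * (η ^ (-σ) * (k : ℝ) ^ σ))) * t := by
    positivity
  exact div_le_div_of_nonneg_right (pow_le_pow_left₀ h0 this k) (by positivity)

/-! ### Measurability and modification on null sets -/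

theorem ae_Ioc_of_ae_nonneg {P : ℝ → Prop} (h : ∀ᵐ τ : ℝ, 0 ≤ τ → P τ) (t : ℝ) :
    ∀ᵐ τ ∂(volume.restrict (Ioc (0 : ℝ) t)), P τ :=
  (ae_restrict_iff' measurableSet_Ioc).2 (h.mono fun _ hτ hm => hτ hm.1.le)

/-- The potential `a + 1` may be replaced by a measurable function which satisfies a growth bound
everywhere, without changing it for almost every time `τ ≥ 0` and almost every point. -/
theorem exists_growthBound_ae_eq {n : ℕ} {a : Rn n → ℝ → ℝ} {Λ : ℝ → ℝ} {σ : ℝ}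
    (ha : LocallyIntegrableOn (fun p : Rn n × ℝ => a p.1 p.2) (univ ×ˢ Ici (0 : ℝ)))
    (hΛ : ∀ T : ℝ, BddAbove (Λ '' Icc 0 T))
    (hbound : ∀ᵐ p : Rn n × ℝ, 0 ≤ p.2 → |a p.1 p.2| ≤ Λ p.2 * ‖p.1‖ ^ σ) :
    ∃ V : Rn n → ℝ → ℝ, GrowthBound V σ ∧
      ∀ᵐ τ : ℝ, 0 ≤ τ → ∀ᵐ y, a y τ + 1 = V y τ := by
  have hM : ∀ k : ℕ, ∃ M : ℝ, 0 ≤ M ∧ ∀ τ ∈ Icc (0 : ℝ) k, Λ τ ≤ M := by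
    intro k
    obtain ⟨M, hM⟩ := hΛ k
    exact ⟨max M 0, le_max_right _ _, fun τ hτ => (hM ⟨τ, hτ, rfl⟩).trans (le_max_left _ _)⟩
  choose M hM0 hM using hM
  have hmeas := ha.aestronglyMeasurable
  set a' : Rn n × ℝ → ℝ := hmeas.mk _ with ha'
  have ha'm : Measurable a' := hmeas.stronglyMeasurable_mk.measurable
  have hae : ∀ᵐ p : Rn n × ℝ, 0 ≤ p.2 → a p.1 p.2 = a' p := by
    have := (ae_restrict_iff' (MeasurableSet.univ.prod measurableSet_Ici)).1 hmeas.ae_eq_mk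
    filter_upwards [this] with p hp h0
    exact hp ⟨mem_univ _, h0⟩
  -- `Λ` need not be measurable; it is replaced by the step function `τ ↦ M ⌈τ⌉₊`.
  set S : Set (Rn n × ℝ) := {p | |a' p| ≤ M ⌈p.2⌉₊ * ‖p.1‖ ^ σ} with hS
  have hSm : MeasurableSet S := by
    refine measurableSet_le (measurable_norm.comp ha'm) (Measurable.mul ?_ ?_)
    · exact (measurable_from_nat (f := M)).comp (Nat.measurable_ceil.comp measurable_snd)
    · exact (measurable_norm.comp measurable_fst).pow_const _
  refine ⟨fun y τ => S.indicator a' (y, τ) + 1,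
    ⟨(ha'm.indicator hSm).add_const 1, fun T => ?_⟩, ?_⟩
  · set C : ℝ := ∑ k ∈ Finset.range (⌈T⌉₊ + 1), M k with hC
    have hC0 : 0 ≤ C := Finset.sum_nonneg fun k _ => hM0 k
    refine ⟨C + 1, by linarith, fun τ hτ y => ?_⟩
    have hr : 0 ≤ ‖y‖ ^ σ := by positivity
    have hMC : M ⌈τ⌉₊ ≤ C := by
      refine Finset.single_le_sum (f := M) (fun k _ => hM0 k) ?_
      exact Finset.mem_range.2 (Nat.lt_succ_of_le (Nat.ceil_le_ceil hτ.2))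
    have h1 : |S.indicator a' (y, τ)| ≤ C * ‖y‖ ^ σ := by
      by_cases h : (y, τ) ∈ S
      · rw [indicator_of_mem h]
        exact le_trans h (mul_le_mul_of_nonneg_right hMC hr)
      · rw [indicator_of_notMem h, abs_zero]
        positivity
    calc |S.indicator a' (y, τ) + 1| ≤ |S.indicator a' (y, τ)| + |1| := abs_add_le _ _
      _ ≤ C * ‖y‖ ^ σ + 1 := by rw [abs_one]; linarith
      _ ≤ _ := by nlinarith
  · have : ∀ᵐ p : Rn n × ℝ, 0 ≤ p.2 → a p.1 p.2 + 1 = S.indicator a' (p.1, p.2) + 1 := by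
      filter_upwards [hae, hbound] with p h1 h2 h0
      rw [indicator_of_mem, h1 h0]
      change |a' p| ≤ M ⌈p.2⌉₊ * ‖p.1‖ ^ σ
      rw [← h1 h0]
      refine (h2 h0).trans (mul_le_mul_of_nonneg_right ?_ (by positivity))
      exact hM _ _ ⟨h0, Nat.le_ceil _⟩
    have hsw : ∀ᵐ q : ℝ × Rn n, 0 ≤ q.1 → a q.2 q.1 + 1 = S.indicator a' (q.2, q.1) + 1 :=
      (Measure.measurePreserving_swap (μ := (volume : Measure ℝ))
        (ν := (volume : Measure (Rn n)))).quasiMeasurePreserving.ae this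
    filter_upwards [Measure.ae_ae_of_ae_prod hsw] with τ hτ h0
    exact hτ.mono fun y hy => hy h0

theorem besselPotential_congr {n : ℕ} {g g' : Rn n → ℝ} (h : ∀ᵐ y, g y = g' y) (x : Rn n) :
    besselPotential g x = besselPotential g' x :=
  integral_congr_ae (h.mono fun y hy => by simp only [hy])

theorem ae_besselPotential_congr {n : ℕ} {V V' : Rn n → ℝ → ℝ}
    (hV : ∀ᵐ τ : ℝ, 0 ≤ τ → ∀ᵐ y, V y τ = V' y τ) {w w' : ℝ → Rn n → ℝ}
    (hw : ∀ τ, 0 ≤ τ → ∀ᵐ y, w τ y = w' τ y) (t : ℝ) (x : Rn n) :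
    (fun τ => besselPotential (fun y => V y τ * w τ y) x)
      =ᵐ[volume.restrict (Ioc (0 : ℝ) t)]
    (fun τ => besselPotential (fun y => V' y τ * w' τ y) x) := by
  refine ae_Ioc_of_ae_nonneg (hV.mono fun τ hτ h0 => ?_) t
  refine besselPotential_congr ?_ x
  filter_upwards [hτ h0, hw τ h0] with y h1 h2
  rw [h1, h2]

theorem hatB_congr {n : ℕ} {V V' : Rn n → ℝ → ℝ}
    (hV : ∀ᵐ τ : ℝ, 0 ≤ τ → ∀ᵐ y, V y τ = V' y τ) {w w' : ℝ → Rn n → ℝ}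
    (hw : ∀ τ, 0 ≤ τ → ∀ᵐ y, w τ y = w' τ y) {t : ℝ} (ht : 0 ≤ t) (x : Rn n) :
    hatB V w t x = hatB V' w' t x := by
  rw [hatB, hatB, intervalIntegral.integral_of_le ht, intervalIntegral.integral_of_le ht]
  exact integral_congr_ae (ae_besselPotential_congr hV hw t x)

theorem HatBDefined.congr {n : ℕ} {V V' : Rn n → ℝ → ℝ}
    (hV : ∀ᵐ τ : ℝ, 0 ≤ τ → ∀ᵐ y, V y τ = V' y τ) {w w' : ℝ → Rn n → ℝ}
    (hw : ∀ τ, 0 ≤ τ → ∀ᵐ y, w τ y = w' τ y) {t : ℝ} (ht : 0 ≤ t) {x : Rn n}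
    (h : HatBDefined V w t x) : HatBDefined V' w' t x := by
  refine ⟨?_, ?_⟩
  · filter_upwards [h.1, ae_Ioc_of_ae_nonneg hV t,
      (ae_restrict_mem measurableSet_Ioc : ∀ᵐ τ ∂(volume.restrict (Ioc (0 : ℝ) t)), _)]
      with τ h1 h2 h3
    refine h1.congr ?_
    filter_upwards [h2, hw τ h3.1.le] with y h4 h5
    rw [h4, h5]
  · rw [intervalIntegrable_iff_integrableOn_Ioc_of_le ht]
    exact ((intervalIntegrable_iff_integrableOn_Ioc_of_le ht).1 h.2).congr
      (ae_besselPotential_congr hV hw t x)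

theorem picardTerm_congr {n : ℕ} {V V' : Rn n → ℝ → ℝ}
    (hV : ∀ᵐ τ : ℝ, 0 ≤ τ → ∀ᵐ y, V y τ = V' y τ) (φ : Rn n → ℝ) (k : ℕ) :
    ∀ t, 0 ≤ t → picardTerm V φ k t = picardTerm V' φ k t := by
  induction k with
  | zero => intro t _; rfl
  | succ k ih =>
    intro t ht
    ext x
    exact hatB_congr hV (fun τ hτ => ae_of_all _ fun y => by rw [ih τ hτ]) ht x

theorem measurable_besselPotential_time {n : ℕ} {V : Rn n → ℝ → ℝ}
    (hV : Measurable (Function.uncurry V)) {w : ℝ → Rn n → ℝ}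
    (hw : Measurable (Function.uncurry w)) :
    Measurable fun p : Rn n × ℝ => besselPotential (fun y => V y p.2 * w p.2 y) p.1 := by
  have h : Measurable fun p : (Rn n × ℝ) × Rn n =>
      besselKernel n (p.1.1 - p.2) * (V p.2 p.1.2 * w p.1.2 p.2) := by
    refine Measurable.mul ?_ (Measurable.mul ?_ ?_)
    · exact (measurable_besselKernel n).comp (by fun_prop)
    · exact hV.comp (measurable_snd.prodMk (measurable_snd.comp measurable_fst))
    · exact hw.comp ((measurable_snd.comp measurable_fst).prodMk measurable_snd)
  exact h.stronglyMeasurable.integral_prod_right'.measurable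

theorem measurable_hatB {n : ℕ} {V : Rn n → ℝ → ℝ}
    (hV : Measurable (Function.uncurry V)) {w : ℝ → Rn n → ℝ}
    (hw : Measurable (Function.uncurry w)) : Measurable (Function.uncurry (hatB V w)) := by
  set g : (ℝ × Rn n) × ℝ → ℝ := fun q => besselPotential (fun y => V y q.2 * w q.2 y) q.1.2
    with hg
  have hgm : Measurable g := by
    have h2 : Measurable fun q : (ℝ × Rn n) × ℝ => (q.1.2, q.2) := by fun_prop
    have := (measurable_besselPotential_time hV hw).comp h2
    simpa only [Function.comp_def] using this
  have hpos : MeasurableSet {q : (ℝ × Rn n) × ℝ | q.2 ∈ Ioc 0 q.1.1} := by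
    have h1 : MeasurableSet {q : (ℝ × Rn n) × ℝ | 0 < q.2} :=
      measurableSet_lt measurable_const measurable_snd
    have h2 : MeasurableSet {q : (ℝ × Rn n) × ℝ | q.2 ≤ q.1.1} :=
      measurableSet_le measurable_snd (by fun_prop)
    exact h1.inter h2
  have hneg : MeasurableSet {q : (ℝ × Rn n) × ℝ | q.2 ∈ Ioc q.1.1 0} := by
    have h1 : MeasurableSet {q : (ℝ × Rn n) × ℝ | q.1.1 < q.2} :=
      measurableSet_lt (by fun_prop) measurable_snd
    have h2 : MeasurableSet {q : (ℝ × Rn n) × ℝ | q.2 ≤ 0} :=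
      measurableSet_le measurable_snd measurable_const
    exact h1.inter h2
  have h : Function.uncurry (hatB V w) = fun p : ℝ × Rn n =>
      (∫ τ, {q : (ℝ × Rn n) × ℝ | q.2 ∈ Ioc 0 q.1.1}.indicator g (p, τ)) -
        ∫ τ, {q : (ℝ × Rn n) × ℝ | q.2 ∈ Ioc q.1.1 0}.indicator g (p, τ) := by
    ext p
    simp only [Function.uncurry, hatB, intervalIntegral]
    rw [← integral_indicator measurableSet_Ioc, ← integral_indicator measurableSet_Ioc]
    rfl
  rw [h]
  exact (hgm.indicator hpos).stronglyMeasurable.integral_prod_right'.measurable.sub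
    (hgm.indicator hneg).stronglyMeasurable.integral_prod_right'.measurable

theorem measurable_picardTerm {n : ℕ} {V : Rn n → ℝ → ℝ} (hV : Measurable (Function.uncurry V))
    {φ : Rn n → ℝ} (hφ : Measurable φ) (k : ℕ) :
    Measurable (Function.uncurry (picardTerm V φ k)) := by
  induction k with
  | zero => exact hφ.comp measurable_snd
  | succ k ih => exact measurable_hatB hV ih

/-! ### The integral operator and its majorant -/

theorem enorm_besselPotential_le {n : ℕ} (V : Rn n → ℝ → ℝ) (w : ℝ → Rn n → ℝ) (τ : ℝ) (x : Rn n) :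
    ‖besselPotential (fun y => V y τ * w τ y) x‖ₑ ≤
      ∫⁻ y, ‖besselKernel n (x - y) * V y τ‖ₑ * ‖w τ y‖ₑ := by
  refine (enorm_integral_le_lintegral_enorm _).trans (le_of_eq (lintegral_congr fun y => ?_))
  rw [← enorm_mul, mul_assoc]

theorem enorm_hatB_le {n : ℕ} (V : Rn n → ℝ → ℝ) (w : ℝ → Rn n → ℝ) {t : ℝ} (ht : 0 ≤ t) (x : Rn n) :
    ‖hatB V w t x‖ₑ ≤ majorant V (fun τ y => ‖w τ y‖ₑ) t x := by
  rw [hatB, intervalIntegral.integral_of_le ht]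
  exact (enorm_integral_le_lintegral_enorm _).trans
    (lintegral_mono fun τ => enorm_besselPotential_le V w τ x)

theorem enorm_picardTerm_le {n : ℕ} (V : Rn n → ℝ → ℝ) (φ : Rn n → ℝ) (k : ℕ) :
    ∀ t, 0 ≤ t → ∀ x, ‖picardTerm V φ k t x‖ₑ ≤
      (majorant V)^[k] (fun _ y => ‖φ y‖ₑ) t x := by
  induction k with
  | zero => intro t _ x; exact le_rfl
  | succ k ih =>
    intro t ht x
    rw [Function.iterate_succ_apply']
    exact (enorm_hatB_le V _ ht x).trans
      (majorant_mono V (fun τ hτ => ae_of_all _ fun y => ih τ hτ.1.le y) x)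

/-- Where the majorant is finite, the iterated integral is a double integral. -/
theorem integrable_prod_of_majorant_lt_top {n : ℕ} {V : Rn n → ℝ → ℝ}
    (hV : Measurable (Function.uncurry V)) {w : ℝ → Rn n → ℝ}
    (hw : Measurable (Function.uncurry w)) {t : ℝ} {x : Rn n}
    (h : majorant V (fun τ y => ‖w τ y‖ₑ) t x < ⊤) :
    Integrable (fun q : ℝ × Rn n => besselKernel n (x - q.2) * (V q.2 q.1 * w q.1 q.2))
      ((volume.restrict (Ioc 0 t)).prod volume) := by
  have hm : Measurable fun q : ℝ × Rn n =>
      besselKernel n (x - q.2) * (V q.2 q.1 * w q.1 q.2) :=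
    ((measurable_besselKernel n).comp (by fun_prop)).mul
      ((hV.comp measurable_swap).mul hw)
  refine ⟨hm.aestronglyMeasurable, ?_⟩
  rw [HasFiniteIntegral, lintegral_prod _ hm.enorm.aemeasurable]
  refine lt_of_le_of_lt (le_of_eq ?_) h
  refine lintegral_congr fun τ => lintegral_congr fun y => ?_
  rw [← enorm_mul, mul_assoc]

theorem hatBDefined_of_majorant_lt_top {n : ℕ} {V : Rn n → ℝ → ℝ}
    (hV : Measurable (Function.uncurry V)) {w : ℝ → Rn n → ℝ}
    (hw : Measurable (Function.uncurry w)) {t : ℝ} (ht : 0 ≤ t) {x : Rn n}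
    (h : majorant V (fun τ y => ‖w τ y‖ₑ) t x < ⊤) : HatBDefined V w t x := by
  have hi := integrable_prod_of_majorant_lt_top hV hw h
  exact ⟨hi.prod_right_ae,
    (intervalIntegrable_iff_integrableOn_Ioc_of_le ht).2 hi.integral_prod_left⟩

theorem hatB_eq_integral_prod {n : ℕ} {V : Rn n → ℝ → ℝ}
    (hV : Measurable (Function.uncurry V)) {w : ℝ → Rn n → ℝ}
    (hw : Measurable (Function.uncurry w)) {t : ℝ} (ht : 0 ≤ t) {x : Rn n}
    (h : majorant V (fun τ y => ‖w τ y‖ₑ) t x < ⊤) :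
    hatB V w t x = ∫ q : ℝ × Rn n, besselKernel n (x - q.2) * (V q.2 q.1 * w q.1 q.2)
      ∂((volume.restrict (Ioc 0 t)).prod volume) := by
  rw [integral_prod _ (integrable_prod_of_majorant_lt_top hV hw h), hatB,
    intervalIntegral.integral_of_le ht]
  rfl

theorem enorm_hatB_sub_hatB_le {n : ℕ} {V : Rn n → ℝ → ℝ} {w : ℝ → Rn n → ℝ} {s t : ℝ}
    (hs : 0 ≤ s) (hst : s ≤ t) {x : Rn n} (h : HatBDefined V w t x) :
    ‖hatB V w t x - hatB V w s x‖ₑ ≤ majorantOn V (fun τ y => ‖w τ y‖ₑ) (Ioc s t) x := by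
  have hs' : IntervalIntegrable (fun τ => besselPotential (fun y => V y τ * w τ y) x)
      volume 0 s := h.2.mono_set (by
        rw [uIcc_of_le hs, uIcc_of_le (hs.trans hst)]; exact Icc_subset_Icc_right hst)
  rw [hatB, hatB, intervalIntegral.integral_interval_sub_left h.2 hs',
    intervalIntegral.integral_of_le hst]
  exact (enorm_integral_le_lintegral_enorm _).trans
    (lintegral_mono fun τ => enorm_besselPotential_le V w τ x)

theorem HatBDefined.hatB_sub {n : ℕ} {V : Rn n → ℝ → ℝ} {w w' : ℝ → Rn n → ℝ} {t : ℝ} (ht : 0 ≤ t)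
    {x : Rn n} (h : HatBDefined V w t x) (h' : HatBDefined V w' t x) :
    hatB V w t x - hatB V w' t x = hatB V (fun τ y => w τ y - w' τ y) t x := by
  rw [hatB, hatB, hatB, ← intervalIntegral.integral_sub h.2 h'.2,
    intervalIntegral.integral_of_le ht, intervalIntegral.integral_of_le ht]
  refine integral_congr_ae ?_
  filter_upwards [h.1, h'.1] with τ h1 h2
  rw [besselPotential, besselPotential, besselPotential, ← integral_sub h1 h2]
  simp only [mul_sub]

/-! ### The Picard series -/

/-- The series of the iterates of the majorant operator, a common bound of the Picard series. -/
def majorantSeries {n : ℕ} (V : Rn n → ℝ → ℝ) (φ : Rn n → ℝ) (t : ℝ) (x : Rn n) : ENNReal :=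
  ∑' k, (majorant V)^[k] (fun _ y => ‖φ y‖ₑ) t x

/-- The sum of the Picard series (with the value `0` where it diverges). -/
def picardSum {n : ℕ} (V : Rn n → ℝ → ℝ) (φ : Rn n → ℝ) (t : ℝ) (x : Rn n) : ℝ :=
  ∑' k, picardTerm V φ k t x

theorem measurable_majorantSeries {n : ℕ} {V : Rn n → ℝ → ℝ} (hV : Measurable (Function.uncurry V))
    {φ : Rn n → ℝ} (hφ : Measurable φ) : Measurable (Function.uncurry (majorantSeries V φ)) := by
  have h0 : Measurable (Function.uncurry fun (_ : ℝ) y => ‖φ y‖ₑ) :=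
    (hφ.comp measurable_snd).enorm
  exact Measurable.tsum fun k => measurable_majorant_iterate hV h0 k

theorem measurable_picardSum {n : ℕ} {V : Rn n → ℝ → ℝ} (hV : Measurable (Function.uncurry V))
    {φ : Rn n → ℝ} (hφ : Measurable φ) : Measurable (Function.uncurry (picardSum V φ)) :=
  Measurable.tsum fun k => measurable_picardTerm hV hφ k

theorem enorm_picardSum_le {n : ℕ} (V : Rn n → ℝ → ℝ) (φ : Rn n → ℝ) {t : ℝ} (ht : 0 ≤ t)
    (x : Rn n) : ‖picardSum V φ t x‖ₑ ≤ majorantSeries V φ t x :=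
  enorm_tsum_le_tsum_enorm.trans (ENNReal.tsum_le_tsum fun k => enorm_picardTerm_le V φ k t ht x)

theorem majorant_iterate_mono_time {n : ℕ} (V : Rn n → ℝ → ℝ) (φ : Rn n → ℝ) (k : ℕ) {s t : ℝ}
    (h : s ≤ t) (x : Rn n) : (majorant V)^[k] (fun _ y => ‖φ y‖ₑ) s x ≤
      (majorant V)^[k] (fun _ y => ‖φ y‖ₑ) t x := by
  cases k with
  | zero => exact le_rfl
  | succ k =>
    rw [Function.iterate_succ_apply']
    exact majorant_mono_time V _ h x

theorem majorantSeries_mono_time {n : ℕ} (V : Rn n → ℝ → ℝ) (φ : Rn n → ℝ) {s t : ℝ}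
    (h : s ≤ t) (x : Rn n) : majorantSeries V φ s x ≤ majorantSeries V φ t x :=
  ENNReal.tsum_le_tsum fun k => majorant_iterate_mono_time V φ k h x

theorem summable_picardTerm {n : ℕ} {V : Rn n → ℝ → ℝ} {φ : Rn n → ℝ} {t : ℝ} (ht : 0 ≤ t)
    {x : Rn n} (h : majorantSeries V φ t x < ⊤) : Summable fun k => picardTerm V φ k t x := by
  have h1 : ∑' k, ‖picardTerm V φ k t x‖ₑ ≠ ⊤ :=
    ((ENNReal.tsum_le_tsum fun k => enorm_picardTerm_le V φ k t ht x).trans_lt h).ne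
  have h2 : Summable fun k => ‖picardTerm V φ k t x‖₊ :=
    ENNReal.tsum_coe_ne_top_iff_summable.1 h1
  exact Summable.of_nnnorm h2

/-- Applying the majorant operator to the majorant series shifts it by one term. -/
theorem majorant_majorantSeries_le {n : ℕ} {V : Rn n → ℝ → ℝ} (hV : Measurable (Function.uncurry V))
    {φ : Rn n → ℝ} (hφ : Measurable φ) (t : ℝ) (x : Rn n) :
    majorant V (majorantSeries V φ) t x ≤ majorantSeries V φ t x := by
  have h0 : Measurable (Function.uncurry fun (_ : ℝ) y => ‖φ y‖ₑ) :=
    (hφ.comp measurable_snd).enorm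
  have hk := fun k => measurable_majorant_iterate hV h0 k
  have hx : Measurable fun p : ℝ × Rn n => (x, p.1) := by fun_prop
  have e1 : ∀ τ, ∫⁻ y, ‖besselKernel n (x - y) * V y τ‖ₑ * majorantSeries V φ τ y =
      ∑' k, ∫⁻ y, ‖besselKernel n (x - y) * V y τ‖ₑ *
        (majorant V)^[k] (fun _ y => ‖φ y‖ₑ) τ y := by
    intro τ
    rw [← lintegral_tsum]
    · simp only [majorantSeries, ENNReal.tsum_mul_left]
    · intro k
      have hmap : Measurable fun y : Rn n => (((x, τ) : Rn n × ℝ), y) := by fun_prop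
      exact ((measurable_majorant_integrand hV (hk k)).comp hmap).aemeasurable
  have e2 : majorant V (majorantSeries V φ) t x =
      ∑' k, (majorant V)^[k + 1] (fun _ y => ‖φ y‖ₑ) t x := by
    simp only [Function.iterate_succ_apply']
    rw [majorant, majorantOn]
    simp_rw [e1]
    rw [lintegral_tsum]
    · rfl
    · intro k
      have hmap : Measurable fun τ : ℝ => ((x, τ) : Rn n × ℝ) := by fun_prop
      exact ((measurable_majorant_inner hV (hk k)).comp hmap).aemeasurable
  rw [e2, majorantSeries]
  exact ENNReal.tsum_comp_le_tsum_of_injective (add_left_injective 1) _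

theorem hatBDefined_picardTerm {n : ℕ} {V : Rn n → ℝ → ℝ} (hV : Measurable (Function.uncurry V))
    {φ : Rn n → ℝ} (hφ : Measurable φ) {t : ℝ} (ht : 0 ≤ t) {x : Rn n}
    (h : majorantSeries V φ t x < ⊤) (k : ℕ) : HatBDefined V (picardTerm V φ k) t x := by
  refine hatBDefined_of_majorant_lt_top hV (measurable_picardTerm hV hφ k) ht ?_
  refine lt_of_le_of_lt (majorant_mono V (fun τ hτ => ae_of_all _ fun y => ?_) x)
    ((majorant_majorantSeries_le hV hφ t x).trans_lt h)
  exact (enorm_picardTerm_le V φ k τ hτ.1.le y).trans (ENNReal.le_tsum k)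

theorem majorant_picardSum_lt_top {n : ℕ} {V : Rn n → ℝ → ℝ}
    (hV : Measurable (Function.uncurry V)) {φ : Rn n → ℝ} (hφ : Measurable φ) {t : ℝ}
    {x : Rn n} (h : majorantSeries V φ t x < ⊤) :
    majorant V (fun τ y => ‖picardSum V φ τ y‖ₑ) t x < ⊤ :=
  lt_of_le_of_lt (majorant_mono V (fun _ hτ => ae_of_all _ fun y =>
    enorm_picardSum_le V φ hτ.1.le y) x) ((majorant_majorantSeries_le hV hφ t x).trans_lt h)

/-- The sum of the Picard series solves the integral equation wherever the majorant series is
finite. -/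
theorem picardSum_eq {n : ℕ} {V : Rn n → ℝ → ℝ} (hV : Measurable (Function.uncurry V))
    {φ : Rn n → ℝ} (hφ : Measurable φ) {t : ℝ} (ht : 0 ≤ t) {x : Rn n}
    (h : majorantSeries V φ t x < ⊤) :
    picardSum V φ t x = φ x + hatB V (picardSum V φ) t x := by
  have hfin : ∀ k, majorant V (fun τ y => ‖picardTerm V φ k τ y‖ₑ) t x ≤
      (majorant V)^[k + 1] (fun _ y => ‖φ y‖ₑ) t x := by
    intro k
    rw [Function.iterate_succ_apply']
    exact majorant_mono V (fun τ hτ => ae_of_all _ fun y =>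
      enorm_picardTerm_le V φ k τ hτ.1.le y) x
  have hsum : ∑' k, (majorant V)^[k + 1] (fun _ y => ‖φ y‖ₑ) t x < ⊤ :=
    (ENNReal.tsum_comp_le_tsum_of_injective (add_left_injective 1) _).trans_lt h
  have hlt : ∀ k, majorant V (fun τ y => ‖picardTerm V φ k τ y‖ₑ) t x < ⊤ := fun k =>
    (hfin k).trans_lt ((ENNReal.le_tsum k).trans_lt hsum)
  have e : hatB V (picardSum V φ) t x = ∑' k, picardTerm V φ (k + 1) t x := by
    rw [hatB_eq_integral_prod hV (measurable_picardSum hV hφ) ht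
      (majorant_picardSum_lt_top hV hφ h)]
    have : ∀ k, picardTerm V φ (k + 1) t x = _ := fun k =>
      hatB_eq_integral_prod hV (measurable_picardTerm hV hφ k) ht (hlt k)
    simp_rw [this]
    rw [← integral_tsum]
    · simp only [picardSum, tsum_mul_left]
    · exact fun k => (integrable_prod_of_majorant_lt_top hV
        (measurable_picardTerm hV hφ k) (hlt k)).1
    · refine (lt_of_le_of_lt (ENNReal.tsum_le_tsum fun k => ?_) hsum).ne
      refine le_trans (le_of_eq ?_) (hfin k)
      rw [lintegral_prod _ (integrable_prod_of_majorant_lt_top hV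
        (measurable_picardTerm hV hφ k) (hlt k)).1.enorm]
      refine lintegral_congr fun τ => lintegral_congr fun y => ?_
      rw [← enorm_mul, mul_assoc]
  rw [e, picardSum, (summable_picardTerm ht h).tsum_eq_zero_add]
  rfl

/-- The remainders of the Picard series are dominated by the tails of the majorant series. -/
theorem enorm_picardSum_sub_sum_le {n : ℕ} {V : Rn n → ℝ → ℝ} {φ : Rn n → ℝ} {t : ℝ}
    (ht : 0 ≤ t) {x : Rn n} (h : majorantSeries V φ t x < ⊤) (N : ℕ) :
    ‖∑ k ∈ Finset.range N, picardTerm V φ k t x - picardSum V φ t x‖ₑ ≤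
      ∑' k, (majorant V)^[k + N] (fun _ y => ‖φ y‖ₑ) t x := by
  have : ∑ k ∈ Finset.range N, picardTerm V φ k t x - picardSum V φ t x =
      -∑' k, picardTerm V φ (k + N) t x := by
    rw [picardSum, ← (summable_picardTerm ht h).sum_add_tsum_nat_add N]
    ring
  rw [this, enorm_neg]
  exact enorm_tsum_le_tsum_enorm.trans
    (ENNReal.tsum_le_tsum fun k => enorm_picardTerm_le V φ (k + N) t ht x)

/-! ### The inductive limit topology -/

theorem ExpSpace.toAE_sub_ae {n : ℕ} (f g : ExpSpace n) :
    ∀ᵐ x, (f - g).toAE x = f.toAE x - g.toAE x :=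
  AEEqFun.coeFn_sub f.toAE g.toAE

theorem ExpSpace.toAE_injective {n : ℕ} : Function.Injective (ExpSpace.toAE (n := n)) :=
  Subtype.val_injective

theorem withSeminorms_stepSeminorms (n : ℕ) : WithSeminorms (stepSeminorms n) := ⟨rfl⟩

theorem integrable_of_mem_weightedL1 {n : ℕ} {ρ : ℝ} {f : Rn n →ₘ[volume] ℝ}
    (hf : f ∈ weightedL1 n ρ) : Integrable fun x => Real.exp (-ρ * ‖x‖) * |f x| := by
  have hf' : Integrable fun x => Real.exp (-ρ * ‖x‖) * f x := hf
  refine hf'.norm.congr (ae_of_all _ fun x => ?_)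
  simp

theorem ofReal_weightedNorm {n : ℕ} {ρ : ℝ} {f : Rn n →ₘ[volume] ℝ} (hf : f ∈ weightedL1 n ρ) :
    ENNReal.ofReal (weightedNorm ρ f) = expLNorm ρ (fun x => ‖f x‖ₑ) := by
  have hi := integrable_of_mem_weightedL1 hf
  rw [weightedNorm, ofReal_integral_eq_lintegral_ofReal hi
    (ae_of_all _ fun x => mul_nonneg (Real.exp_pos _).le (abs_nonneg _))]
  refine lintegral_congr fun x => ?_
  simp only [ENNReal.ofReal_mul (Real.exp_pos _).le, Real.enorm_eq_ofReal_abs]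

theorem mem_weightedL1_iff {n : ℕ} {ρ : ℝ} {f : Rn n →ₘ[volume] ℝ} :
    f ∈ weightedL1 n ρ ↔ expLNorm ρ (fun x => ‖f x‖ₑ) < ⊤ := by
  have hm : AEStronglyMeasurable (fun x : Rn n => Real.exp (-ρ * ‖x‖) * f x) volume :=
    (by fun_prop : Continuous fun x : Rn n =>
      Real.exp (-ρ * ‖x‖)).aestronglyMeasurable.mul f.aestronglyMeasurable
  have e : ∫⁻ x, ‖Real.exp (-ρ * ‖x‖) * f x‖ₑ = expLNorm ρ (fun x => ‖f x‖ₑ) := by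
    refine lintegral_congr fun x => ?_
    rw [enorm_mul, Real.enorm_of_nonneg (Real.exp_pos _).le]
  rw [← e]
  exact ⟨fun h => h.2, fun h => ⟨hm, h⟩⟩

/-- A curve in `𝓔` is continuous as soon as, on bounded time intervals, it is Lipschitz continuous
in one of the spaces `𝓔_ρ`. -/
theorem continuous_of_lipschitz_step {n : ℕ} {u : ℝ≥0 → ExpSpace n}
    (h : ∀ T : ℝ≥0, ∃ ρ ∈ Ico (0 : ℝ) 1, ∃ C : ℝ, ∀ s t : ℝ≥0, s ≤ t → t ≤ T →
      (u t - u s).toAE ∈ weightedL1 n ρ ∧ weightedNorm ρ (u t - u s).toAE ≤ C * (t - s)) :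
    Continuous u := by
  refine continuous_iff_continuousAt.2 fun t₀ => ?_
  refine ((withSeminorms_stepSeminorms n).tendsto_nhds u (u t₀)).2 fun i ε hε => ?_
  obtain ⟨ρ, hρ, C, hC⟩ := h (t₀ + 1)
  obtain ⟨D, hD⟩ := i.2 ρ hρ
  have key : ∀ s t : ℝ≥0, s ≤ t → t ≤ t₀ + 1 → stepSeminorms n i (u t - u s) ≤
      |D| * |C| * dist t s := by
    intro s t hst ht
    obtain ⟨h1, h2⟩ := hC s t hst ht
    have hst' : (0 : ℝ) ≤ t - s := sub_nonneg.2 (NNReal.coe_le_coe.2 hst)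
    have hnn : 0 ≤ weightedNorm ρ (u t - u s).toAE :=
      integral_nonneg fun x => mul_nonneg (Real.exp_pos _).le (abs_nonneg _)
    calc stepSeminorms n i (u t - u s) ≤ D * weightedNorm ρ (u t - u s).toAE := hD _ h1
      _ ≤ |D| * (|C| * (t - s)) := by
          refine mul_le_mul (le_abs_self _) (h2.trans ?_) hnn (abs_nonneg _)
          exact mul_le_mul_of_nonneg_right (le_abs_self _) hst'
      _ = |D| * |C| * dist t s := by
          rw [NNReal.dist_eq, abs_of_nonneg hst']; ring
  have hev : ∀ᶠ t in 𝓝 t₀, t < t₀ + 1 := Iio_mem_nhds (lt_add_of_pos_right _ one_pos)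
  have hlim : Tendsto (fun t => |D| * |C| * dist t t₀) (𝓝 t₀) (𝓝 0) := by
    have hc : Continuous fun t : ℝ≥0 => |D| * |C| * dist t t₀ := by fun_prop
    simpa using hc.tendsto t₀
  filter_upwards [hev, hlim.eventually_lt_const hε] with t ht1 ht2
  refine lt_of_le_of_lt ?_ ht2
  rcases le_total t₀ t with h0 | h0
  · exact key t₀ t h0 ht1.le
  · rw [dist_comm, map_sub_rev]
    exact key t t₀ h0 (le_add_of_nonneg_right zero_le_one)

/-- A weight which is `O(e^{-ρ|x|})` for every `ρ < 1`. -/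
structure RapidWeight {n : ℕ} (g : Rn n → ℝ) : Prop where
  measurable : Measurable g
  nonneg : ∀ x, 0 ≤ g x
  decay : ∀ ρ ∈ Ico (0 : ℝ) 1, ∃ C : ℝ, 0 ≤ C ∧ ∀ x, g x ≤ C * Real.exp (-ρ * ‖x‖)

theorem RapidWeight.integrable {n : ℕ} {g : Rn n → ℝ} (hg : RapidWeight g) (f : ExpSpace n) :
    Integrable fun x => g x * |f.toAE x| := by
  obtain ⟨ρ, hρ, hf⟩ := f.2
  obtain ⟨C, hC, hgC⟩ := hg.decay ρ hρ
  refine Integrable.mono' ((integrable_of_mem_weightedL1 hf).const_mul C)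
    (hg.measurable.aestronglyMeasurable.mul f.toAE.aestronglyMeasurable.norm)
    (ae_of_all _ fun x => ?_)
  rw [Real.norm_of_nonneg (mul_nonneg (hg.nonneg x) (abs_nonneg _)), ← mul_assoc]
  exact mul_le_mul_of_nonneg_right (hgC x) (abs_nonneg _)

/-- The seminorm `f ↦ ∫ g |f|`, which is continuous on every `𝓔_ρ` and hence on `𝓔`. -/
def RapidWeight.seminorm {n : ℕ} {g : Rn n → ℝ} (hg : RapidWeight g) : Seminorm ℝ (ExpSpace n) :=
  Seminorm.of (fun f => ∫ x, g x * |f.toAE x|)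
    (fun f f' => by
      rw [← integral_add (hg.integrable f) (hg.integrable f')]
      refine integral_mono_ae (hg.integrable (f + f'))
        ((hg.integrable f).add (hg.integrable f')) ?_
      filter_upwards [AEEqFun.coeFn_add f.toAE f'.toAE] with x hx
      have : (f + f').toAE x = f.toAE x + f'.toAE x := hx
      rw [this, ← mul_add]
      exact mul_le_mul_of_nonneg_left (abs_add_le _ _) (hg.nonneg x))
    (fun c f => by
      rw [← integral_const_mul]
      refine integral_congr_ae ?_
      filter_upwards [AEEqFun.coeFn_smul c f.toAE] with x hx
      have : (c • f).toAE x = c * f.toAE x := hx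
      rw [this, abs_mul, Real.norm_eq_abs]
      ring)

theorem RapidWeight.seminorm_apply {n : ℕ} {g : Rn n → ℝ} (hg : RapidWeight g) (f : ExpSpace n) :
    hg.seminorm f = ∫ x, g x * |f.toAE x| := rfl

theorem RapidWeight.continuous_seminorm {n : ℕ} {g : Rn n → ℝ} (hg : RapidWeight g) :
    Continuous hg.seminorm := by
  refine (withSeminorms_stepSeminorms n).continuous_seminorm ⟨hg.seminorm, fun ρ hρ => ?_⟩
  obtain ⟨C, hC, hgC⟩ := hg.decay ρ hρ
  refine ⟨C, fun f hf => ?_⟩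
  rw [seminorm_apply, weightedNorm, ← integral_const_mul]
  have hi := integrable_of_mem_weightedL1 hf
  refine integral_mono (hg.integrable f) (hi.const_mul C) fun x => ?_
  simp only [← mul_assoc]
  exact mul_le_mul_of_nonneg_right (hgC x) (abs_nonneg _)

/-! ### Compact curves lie in one step -/

/-- A gliding hump: if no bound held in any of the steps with `ρ_i = 1 - 1/(i+1)`, finitely
extended pieces of the weights `2^{-i} e^{-ρ_i|x|}` would add up to a rapid weight whose seminorm is
unbounded along the curve. -/
theorem exists_step_bound {n : ℕ} (u : C(ℝ≥0, ExpSpace n)) (T : ℝ≥0) :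
    ∃ ρ ∈ Ico (0 : ℝ) 1, ∃ C : ℝ, ∀ t ≤ T,
      expLNorm ρ (fun x => ‖(u t).toAE x‖ₑ) ≤ ENNReal.ofReal C := by
  set r : ℕ → ℝ := fun i => 1 - 1 / ((i : ℝ) + 1) with hr
  have hr1 : ∀ i, r i < 1 := fun i => by
    have : 0 < 1 / ((i : ℝ) + 1) := by positivity
    simp only [hr]; linarith
  have hr0 : ∀ i, 0 ≤ r i := fun i => by
    have : 1 / ((i : ℝ) + 1) ≤ 1 := by
      rw [div_le_one (by positivity)]; linarith [(Nat.cast_nonneg i : (0 : ℝ) ≤ i)]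
    simp only [hr]; linarith
  by_contra hcon
  push Not at hcon
  -- The factor `2 ^ i` compensates the factor `2 ^ (-i)` in the weight constructed below.
  have h1 : ∀ i : ℕ, ∃ t ≤ T, ENNReal.ofReal (i * 2 ^ i) <
      expLNorm (r i) (fun x => ‖(u t).toAE x‖ₑ) := fun i => hcon (r i) ⟨hr0 i, hr1 i⟩ _
  choose t htT ht using h1
  have h2 : ∀ i : ℕ, ∃ R : ℕ, ENNReal.ofReal (i * 2 ^ i) <
      ∫⁻ x in Metric.closedBall (0 : Rn n) R,
        ENNReal.ofReal (Real.exp (-r i * ‖x‖)) * ‖(u (t i)).toAE x‖ₑ := by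
    intro i
    have hU : ⋃ R : ℕ, Metric.closedBall (0 : Rn n) R = univ := Metric.iUnion_closedBall_nat 0
    have hdir : Directed (· ⊆ ·) fun R : ℕ => Metric.closedBall (0 : Rn n) R :=
      Monotone.directed_le fun a b hab => Metric.closedBall_subset_closedBall (by exact_mod_cast hab)
    have := ht i
    rw [expLNorm, ← setLIntegral_univ, ← hU, setLIntegral_iUnion_of_directed _ hdir] at this
    exact lt_iSup_iff.1 this
  choose R hR using h2
  set h : ℕ → Rn n → ℝ := fun i x => (1 / 2) ^ i *
    (Metric.closedBall (0 : Rn n) (R i)).indicator (fun x => Real.exp (-r i * ‖x‖)) x with hh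
  have hh0 : ∀ i x, 0 ≤ h i x := fun i x =>
    mul_nonneg (by positivity) (indicator_nonneg (fun _ _ => (Real.exp_pos _).le) _)
  have hhm : ∀ i, Measurable (h i) := fun i =>
    ((by fun_prop : Continuous fun x : Rn n => Real.exp (-r i * ‖x‖)).measurable.indicator
      Metric.isClosed_closedBall.measurableSet).const_mul _
  have hdecay : ∀ ρ ∈ Ico (0 : ℝ) 1, ∃ D : ℝ, 0 ≤ D ∧
      ∀ i x, h i x ≤ (1 / 2) ^ i * (D * Real.exp (-ρ * ‖x‖)) := by
    intro ρ hρ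
    -- For `i ≥ I` one has `r i ≥ ρ`; each of the other terms has bounded support.
    obtain ⟨I, hI⟩ := exists_nat_one_div_lt (sub_pos.2 hρ.2)
    have hD0 : (0 : ℝ) ≤ ∑ i ∈ Finset.range I, Real.exp (R i) :=
      Finset.sum_nonneg fun _ _ => (Real.exp_pos _).le
    refine ⟨∑ i ∈ Finset.range I, Real.exp (R i) + 1, by linarith, fun i x => ?_⟩
    refine mul_le_mul_of_nonneg_left ?_ (by positivity)
    have hx := norm_nonneg x
    by_cases hxR : x ∈ Metric.closedBall (0 : Rn n) (R i)
    · rw [indicator_of_mem hxR]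
      rcases lt_or_ge i I with hi | hi
      · have h3 : Real.exp (R i) ≤ ∑ i ∈ Finset.range I, Real.exp (R i) :=
          Finset.single_le_sum (f := fun i => Real.exp (R i)) (fun _ _ => (Real.exp_pos _).le)
            (Finset.mem_range.2 hi)
        have h4 : Real.exp (-r i * ‖x‖) ≤ Real.exp (R i) * Real.exp (-ρ * ‖x‖) := by
          rw [← Real.exp_add]
          refine Real.exp_le_exp.2 ?_
          have h5 : ‖x‖ ≤ R i := by simpa using hxR
          nlinarith [hr0 i, hρ.2, hρ.1]
        nlinarith [Real.exp_pos (-ρ * ‖x‖)]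
      · have h3 : ρ ≤ r i := by
          have : 1 / ((i : ℝ) + 1) ≤ 1 / ((I : ℝ) + 1) := by
            refine one_div_le_one_div_of_le (by positivity) ?_
            have : (I : ℝ) ≤ i := by exact_mod_cast hi
            linarith
          simp only [hr]; linarith
        have h4 : Real.exp (-r i * ‖x‖) ≤ Real.exp (-ρ * ‖x‖) :=
          Real.exp_le_exp.2 (by nlinarith)
        nlinarith [Real.exp_pos (-ρ * ‖x‖)]
    · rw [indicator_of_notMem hxR]
      have : 0 ≤ ∑ i ∈ Finset.range I, Real.exp (R i) + 1 := by linarith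
      positivity
  have hgeom : Summable fun i : ℕ => ((1 : ℝ) / 2) ^ i := summable_geometric_two
  have hsum : ∀ x, Summable fun i => h i x := fun x => by
    obtain ⟨D, hD, hDh⟩ := hdecay 0 ⟨le_rfl, one_pos⟩
    exact Summable.of_nonneg_of_le (fun i => hh0 i x) (fun i => hDh i x) (hgeom.mul_right _)
  have hg : RapidWeight fun x => ∑' i, h i x := by
    refine ⟨Measurable.tsum hhm, fun x => tsum_nonneg fun i => hh0 i x, fun ρ hρ => ?_⟩
    obtain ⟨D, hD, hDh⟩ := hdecay ρ hρ
    refine ⟨2 * D, by positivity, fun x => ?_⟩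
    calc ∑' i, h i x ≤ ∑' i : ℕ, ((1 : ℝ) / 2) ^ i * (D * Real.exp (-ρ * ‖x‖)) :=
          (hsum x).tsum_le_tsum (fun i => hDh i x) (hgeom.mul_right _)
      _ = _ := by rw [tsum_mul_right, tsum_geometric_two]; ring
  have hK : BddAbove ((fun t => hg.seminorm (u t)) '' Icc 0 T) :=
    isCompact_Icc.bddAbove_image (hg.continuous_seminorm.comp u.continuous).continuousOn
  obtain ⟨M, hM⟩ := hK
  obtain ⟨i, hi⟩ := exists_nat_gt M
  have hle : hg.seminorm (u (t i)) ≤ M := hM ⟨t i, ⟨zero_le, htT i⟩, rfl⟩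
  have hge : ENNReal.ofReal i ≤ ENNReal.ofReal (hg.seminorm (u (t i))) := by
    rw [hg.seminorm_apply, ofReal_integral_eq_lintegral_ofReal (hg.integrable _)
      (ae_of_all _ fun x => mul_nonneg (hg.nonneg x) (abs_nonneg _))]
    calc ENNReal.ofReal i = ENNReal.ofReal ((1 / 2) ^ i) * ENNReal.ofReal (i * 2 ^ i) := by
          rw [← ENNReal.ofReal_mul (by positivity)]
          congr 1
          rw [mul_left_comm, ← mul_pow]; norm_num
      _ ≤ ENNReal.ofReal ((1 / 2) ^ i) * ∫⁻ x in Metric.closedBall (0 : Rn n) (R i),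
            ENNReal.ofReal (Real.exp (-r i * ‖x‖)) * ‖(u (t i)).toAE x‖ₑ := by
          gcongr; exact (hR i).le
      _ ≤ _ := by
          rw [← lintegral_const_mul' _ _ ENNReal.ofReal_ne_top,
            ← lintegral_indicator Metric.isClosed_closedBall.measurableSet]
          refine lintegral_mono fun x => ?_
          by_cases hxR : x ∈ Metric.closedBall (0 : Rn n) (R i)
          · rw [indicator_of_mem hxR, ENNReal.ofReal_mul (hg.nonneg x), ← Real.enorm_eq_ofReal_abs,
              ← mul_assoc, ← ENNReal.ofReal_mul (by positivity)]
            refine mul_le_mul_left (ENNReal.ofReal_le_ofReal ?_) _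
            have := (hsum x).le_tsum i fun j _ => hh0 j x
            refine le_trans (le_of_eq ?_) this
            simp only [hh]
            rw [indicator_of_mem hxR]
          · rw [indicator_of_notMem hxR]
            exact zero_le
  have hi0 : (0 : ℝ) ≤ hg.seminorm (u (t i)) := apply_nonneg _ _
  linarith [(ENNReal.ofReal_le_ofReal_iff hi0).1 hge]

/-! ### Jointly measurable versions of curves -/

theorem rapidWeight_indicator_ball {n : ℕ} (R : ℝ) :
    RapidWeight ((Metric.closedBall (0 : Rn n) R).indicator fun _ => (1 : ℝ)) := by
  refine ⟨measurable_const.indicator Metric.isClosed_closedBall.measurableSet,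
    indicator_nonneg fun _ _ => zero_le_one, fun ρ hρ => ⟨Real.exp |R|, by positivity, fun x => ?_⟩⟩
  by_cases h : x ∈ Metric.closedBall (0 : Rn n) R
  · rw [indicator_of_mem h, ← Real.exp_add]
    refine Real.one_le_exp ?_
    have h5 : ‖x‖ ≤ R := by simpa using h
    nlinarith [norm_nonneg x, le_abs_self R, hρ.1, hρ.2]
  · rw [indicator_of_notMem h]
    positivity

theorem ExpSpace.integrableOn_closedBall {n : ℕ} (f : ExpSpace n) (R : ℝ) :
    IntegrableOn f.toAE (Metric.closedBall 0 R) := by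
  have h := (rapidWeight_indicator_ball (n := n) R).integrable f
  rw [← integrable_indicator_iff Metric.isClosed_closedBall.measurableSet]
  refine h.mono (f.toAE.aestronglyMeasurable.indicator Metric.isClosed_closedBall.measurableSet)
    (ae_of_all _ fun x => ?_)
  by_cases hx : x ∈ Metric.closedBall (0 : Rn n) R
  · simp [indicator_of_mem hx]
  · simp [indicator_of_notMem hx]

theorem ExpSpace.locallyIntegrable {n : ℕ} (f : ExpSpace n) : LocallyIntegrable f.toAE := by
  refine (locallyIntegrable_iff).2 fun K hK => ?_
  obtain ⟨R, hR⟩ := hK.isBounded.subset_closedBall 0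
  exact (f.integrableOn_closedBall R).mono_set hR

theorem continuous_setIntegral_ball {n : ℕ} (u : C(ℝ≥0, ExpSpace n)) (x : Rn n) (r : ℝ) :
    Continuous fun t => ∫ y in Metric.closedBall x r, (u t).toAE y := by
  have hsub : Metric.closedBall x r ⊆ Metric.closedBall (0 : Rn n) (‖x‖ + r) :=
    Metric.closedBall_subset_closedBall' (by rw [dist_zero_right, add_comm])
  have hg := rapidWeight_indicator_ball (n := n) (‖x‖ + r)
  refine continuous_iff_continuousAt.2 fun s => tendsto_iff_norm_sub_tendsto_zero.2 ?_
  have hlim : Tendsto (fun t => hg.seminorm (u t - u s)) (𝓝 s) (𝓝 0) := by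
    refine Metric.tendsto_nhds.2 fun ε hε => ?_
    have hball : {f : ExpSpace n | hg.seminorm (f - u s) < ε} ∈ 𝓝 (u s) := by
      let _ := (withSeminorms_stepSeminorms n).topologicalAddGroup
      refine IsOpen.mem_nhds (isOpen_lt (hg.continuous_seminorm.comp
        (continuous_id.sub continuous_const)) continuous_const) ?_
      simpa using hε
    filter_upwards [u.continuous.continuousAt.preimage_mem_nhds hball] with t ht
    rw [Real.dist_0_eq_abs, abs_of_nonneg (apply_nonneg _ _)]
    exact ht
  refine squeeze_zero (fun _ => norm_nonneg _) (fun t => ?_) hlim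
  rw [← integral_sub (((u t).integrableOn_closedBall _).mono_set hsub)
    (((u s).integrableOn_closedBall _).mono_set hsub), hg.seminorm_apply]
  refine (norm_integral_le_integral_norm _).trans ?_
  rw [← integral_indicator Metric.isClosed_closedBall.measurableSet]
  refine integral_mono_of_nonneg (ae_of_all _ fun y =>
    indicator_nonneg (fun _ _ => norm_nonneg _) _) (hg.integrable _) ?_
  filter_upwards [ExpSpace.toAE_sub_ae (u t) (u s)] with y hy
  by_cases hyr : y ∈ Metric.closedBall x r
  · rw [indicator_of_mem hyr, indicator_of_mem (hsub hyr), hy, one_mul, Real.norm_eq_abs]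
  · rw [indicator_of_notMem hyr]
    exact mul_nonneg (hg.nonneg y) (abs_nonneg _)

/-- A continuous curve in `𝓔` has a jointly measurable version. Its averages over balls of radius
`1/(m+1)` are continuous in time and measurable in space, hence jointly measurable, and by
Lebesgue's differentiation theorem they converge almost everywhere at each time. -/
theorem exists_measurable_version {n : ℕ} (hn : 1 ≤ n) (u : C(ℝ≥0, ExpSpace n)) :
    ∃ U : ℝ → Rn n → ℝ, Measurable (Function.uncurry U) ∧
      ∀ t : ℝ, ∀ᵐ x, U t x = (u t.toNNReal).toAE x := by
  have : Nonempty (Fin n) := ⟨⟨0, hn⟩⟩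
  set A : ℕ → ℝ → Rn n → ℝ := fun m t x =>
    ⨍ y in Metric.closedBall x (1 / ((m : ℝ) + 1)), (u t.toNNReal).toAE y with hA
  have hAeq : ∀ m t x, A m t x =
      (volume.real (Metric.closedBall (0 : Rn n) (1 / ((m : ℝ) + 1))))⁻¹ *
        ∫ y in Metric.closedBall x (1 / ((m : ℝ) + 1)), (u t.toNNReal).toAE y := by
    intro m t x
    simp only [hA]
    rw [setAverage_eq, Measure.addHaar_real_closedBall_center, smul_eq_mul]
  have hAm : ∀ m, StronglyMeasurable (Function.uncurry (A m)) := by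
    intro m
    refine stronglyMeasurable_uncurry_of_continuous_of_stronglyMeasurable (fun x => ?_) fun t => ?_
    -- The volume of the ball does not depend on its centre.
    · simp_rw [hAeq]
      exact continuous_const.mul
        ((continuous_setIntegral_ball u x _).comp continuous_real_toNNReal)
    · set S : Set (Rn n × Rn n) := {p | dist p.2 p.1 ≤ 1 / ((m : ℝ) + 1)} with hS
      have hSm : MeasurableSet S :=
        (isClosed_le (by fun_prop) continuous_const).measurableSet
      have hf : StronglyMeasurable (S.indicator fun p => (u t.toNNReal).toAE p.2) :=
        ((u t.toNNReal).toAE.stronglyMeasurable.comp_measurable measurable_snd).indicator hSm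
      have e : A m t = fun x =>
          (volume.real (Metric.closedBall (0 : Rn n) (1 / ((m : ℝ) + 1))))⁻¹ *
            ∫ y, S.indicator (fun p => (u t.toNNReal).toAE p.2) (x, y) := by
        ext x
        rw [hAeq, ← integral_indicator Metric.isClosed_closedBall.measurableSet]
        rfl
      rw [e]
      exact stronglyMeasurable_const.mul hf.integral_prod_right'
  have hlim := StronglyMeasurable.limUnder (l := atTop) hAm
  refine ⟨fun t x => limUnder atTop fun m => A m t x, hlim.measurable, fun t => ?_⟩
  filter_upwards [IsUnifLocDoublingMeasure.ae_tendsto_average volume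
    (u t.toNNReal).locallyIntegrable 1] with x hx
  refine Tendsto.limUnder_eq (hx (fun _ => x) (fun m : ℕ => 1 / ((m : ℝ) + 1)) ?_ ?_)
  · exact tendsto_nhdsWithin_iff.2 ⟨tendsto_one_div_add_atTop_nhds_zero_nat,
      Eventually.of_forall fun m => by simp only [mem_Ioi]; positivity⟩
  · exact Eventually.of_forall fun m => Metric.mem_closedBall_self (by positivity)

/-! ### Uniqueness -/

/-- A function dominated by its own majorant vanishes: it is dominated by all iterates, whose norms
tend to zero. -/
theorem ae_eq_zero_of_le_majorant {n : ℕ} (hn : 1 ≤ n) {V : Rn n → ℝ → ℝ} {σ : ℝ}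
    (hV : GrowthBound V σ) (hσ0 : 0 ≤ σ) (hσ1 : σ < 1) {ρ : ℝ} (hρ : ρ ∈ Ico (0 : ℝ) 1) {T : ℝ}
    (hT : 0 ≤ T) {w : ℝ → Rn n → ENNReal} (hw : Measurable (Function.uncurry w)) {m : ENNReal}
    (hm : m ≠ ⊤) (hwm : ∀ t ∈ Icc 0 T, expLNorm ρ (w t) ≤ m)
    (hle : ∀ t, 0 ≤ t → ∀ᵐ x, w t x ≤ majorant V w t x) : ∀ᵐ x, w T x = 0 := by
  obtain ⟨b, hb0, hbs, hb⟩ := exists_summable_bound hn hV hσ0 hσ1 hρ.1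
    (ρ₁ := (ρ + 1) / 2) (by linarith [hρ.2]) (by linarith [hρ.2]) hT
  have hiter : ∀ k, ∀ t, 0 ≤ t → ∀ᵐ x, w t x ≤ (majorant V)^[k] w t x := by
    intro k
    induction k with
    | zero => exact fun t _ => ae_of_all _ fun x => le_rfl
    | succ k ih =>
      intro t ht
      rw [Function.iterate_succ_apply']
      filter_upwards [hle t ht] with x hx
      exact hx.trans (majorant_mono V (fun τ hτ => ih τ hτ.1.le) x)
  have hTT : T ∈ Icc 0 T := ⟨hT, le_rfl⟩
  have hbound : ∀ k, expLNorm ((ρ + 1) / 2) (w T) ≤ m * ENNReal.ofReal (b k) := fun k =>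
    (expLNorm_mono _ (hiter k T hT)).trans (hb w m hw hwm k T hTT)
  have hlim : Tendsto (fun k => m * ENNReal.ofReal (b k)) atTop (𝓝 0) := by
    have h1 := (ENNReal.continuous_ofReal.tendsto 0).comp hbs.tendsto_atTop_zero
    have h2 := ENNReal.Tendsto.const_mul h1 (Or.inr hm)
    simpa using h2
  have hzero : expLNorm ((ρ + 1) / 2) (w T) = 0 := le_antisymm
    (ge_of_tendsto' hlim hbound) zero_le
  have hwT : Measurable (w T) := hw.comp (measurable_const.prodMk measurable_id)
  have hW : Measurable fun x => ENNReal.ofReal (Real.exp (-((ρ + 1) / 2) * ‖x‖)) * w T x :=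
    (measurable_expWeight _).mul hwT
  rw [expLNorm, lintegral_eq_zero_iff hW] at hzero
  filter_upwards [hzero] with x hx
  rcases mul_eq_zero.1 hx with h | h
  · exact absurd h (by simp [Real.exp_pos])
  · exact h

/-- Two mild solutions agree: `e^t` times their difference satisfies the homogeneous integral
equation, hence is dominated by its own majorant. -/
theorem IsMildSolution.unique {n : ℕ} (hn : 1 ≤ n) {a V : Rn n → ℝ → ℝ} {σ : ℝ}
    (hV : GrowthBound V σ) (hσ0 : 0 ≤ σ) (hσ1 : σ < 1)
    (haV : ∀ᵐ τ : ℝ, 0 ≤ τ → ∀ᵐ y, a y τ + 1 = V y τ) {u₀ : ExpSpace n}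
    {u v : C(ℝ≥0, ExpSpace n)} (hu : IsMildSolution a u₀ u) (hv : IsMildSolution a u₀ v) :
    u = v := by
  let d : C(ℝ≥0, ExpSpace n) := ⟨fun t => u t - v t, by
    let _ := (withSeminorms_stepSeminorms n).topologicalAddGroup
    exact u.continuous.sub v.continuous⟩
  obtain ⟨D, hDm, hD⟩ := exists_measurable_version hn d
  -- `W` is a jointly measurable version of `e^t (u(t) - v(t))`, to which Tonelli's theorem applies.
  set W : ℝ → Rn n → ℝ := fun t x => Real.exp t * D t x with hW
  have hWm : Measurable (Function.uncurry W) :=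
    (Real.measurable_exp.comp measurable_fst).mul hDm
  have hWe : ∀ t : ℝ, ∀ᵐ x, Real.exp t * (u t.toNNReal).toAE x -
      Real.exp t * (v t.toNNReal).toAE x = W t x := by
    intro t
    filter_upwards [hD t, ExpSpace.toAE_sub_ae (u t.toNNReal) (v t.toNNReal)] with x h1 h2
    have h3 : D t x = (u t.toNNReal).toAE x - (v t.toNNReal).toAE x := h1.trans h2
    simp only [hW]
    rw [h3]; ring
  have hle : ∀ t, 0 ≤ t → ∀ᵐ x, ‖W t x‖ₑ ≤ majorant V (fun τ y => ‖W τ y‖ₑ) t x := by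
    intro t ht
    filter_upwards [hu t ht, hv t ht, hWe t] with x h1 h2 h3
    have h4 : W t x = hatB V W t x := by
      rw [← h3, h1.2, h2.2, add_sub_add_left_eq_sub, h1.1.hatB_sub ht h2.1]
      exact hatB_congr haV (fun τ _ => hWe τ) ht x
    calc ‖W t x‖ₑ = ‖hatB V W t x‖ₑ := by rw [← h4]
      _ ≤ _ := enorm_hatB_le V W ht x
  ext1 T
  obtain ⟨ρ, hρ, C, hC⟩ := exists_step_bound d T
  have hbd : ∀ t ∈ Icc (0 : ℝ) T, expLNorm ρ (fun x => ‖W t x‖ₑ) ≤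
      ENNReal.ofReal (Real.exp T) * ENNReal.ofReal C := by
    intro t ht
    have h1 : t.toNNReal ≤ T := Real.toNNReal_le_iff_le_coe.2 ht.2
    refine le_trans ?_ (mul_le_mul_right (hC _ h1) _)
    rw [expLNorm, expLNorm, ← lintegral_const_mul' _ _ ENNReal.ofReal_ne_top]
    refine lintegral_mono_ae ?_
    filter_upwards [hD t] with x hx
    simp only [hW]
    rw [hx, enorm_mul, Real.enorm_of_nonneg (Real.exp_pos t).le, mul_left_comm]
    gcongr
    exact ht.2
  have h0 := ae_eq_zero_of_le_majorant (w := fun t x => ‖W t x‖ₑ) hn hV hσ0 hσ1 hρ T.2 hWm.enorm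
    (ENNReal.mul_ne_top ENNReal.ofReal_ne_top ENNReal.ofReal_ne_top) hbd hle
  apply ExpSpace.toAE_injective
  refine AEEqFun.ext ?_
  filter_upwards [h0, hWe T] with x h1 h2
  have h3 : W T x = 0 := enorm_eq_zero.1 h1
  rw [h3, Real.toNNReal_coe, ← mul_sub] at h2
  exact sub_eq_zero.1 ((mul_eq_zero.1 h2).resolve_left (Real.exp_pos _).ne')

/-! ### Existence -/

theorem expLNorm_tsum_iterate_le {n : ℕ} {V : Rn n → ℝ → ℝ} (hV : Measurable (Function.uncurry V))
    {φ : Rn n → ℝ} (hφ : Measurable φ) {ρ t : ℝ} {m : ENNReal} {b : ℕ → ℝ} (hb0 : ∀ k, 0 ≤ b k)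
    (hbs : Summable b) (hb : ∀ k, expLNorm ρ ((majorant V)^[k] (fun _ y => ‖φ y‖ₑ) t) ≤
      m * ENNReal.ofReal (b k)) (N : ℕ) :
    expLNorm ρ (fun x => ∑' k, (majorant V)^[k + N] (fun _ y => ‖φ y‖ₑ) t x) ≤
      m * ENNReal.ofReal (∑' k, b (k + N)) := by
  have h0 : Measurable (Function.uncurry fun (_ : ℝ) y => ‖φ y‖ₑ) :=
    (hφ.comp measurable_snd).enorm
  have hk : ∀ k, Measurable fun x => ENNReal.ofReal (Real.exp (-ρ * ‖x‖)) *
      (majorant V)^[k + N] (fun _ y => ‖φ y‖ₑ) t x := fun k =>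
    (measurable_expWeight ρ).mul ((measurable_majorant_iterate hV h0 (k + N)).comp
      (measurable_const.prodMk measurable_id))
  rw [expLNorm]
  simp_rw [← ENNReal.tsum_mul_left]
  rw [lintegral_tsum fun k => (hk k).aemeasurable,
    ENNReal.ofReal_tsum_of_nonneg (fun k => hb0 _) ((summable_nat_add_iff N).2 hbs),
    ← ENNReal.tsum_mul_left]
  exact ENNReal.tsum_le_tsum fun k => hb (k + N)

/-- The majorant series of an element of `𝓔_ρ₀` converges in `𝓔_ρ₁` for every `ρ₁ > ρ₀`, with
uniform bounds for its tails on bounded time intervals. -/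
theorem exists_tail_bound {n : ℕ} (hn : 1 ≤ n) {V : Rn n → ℝ → ℝ} {σ : ℝ}
    (hV : GrowthBound V σ) (hσ0 : 0 ≤ σ) (hσ1 : σ < 1) {ρ₀ ρ₁ : ℝ} (h0 : 0 ≤ ρ₀) (h01 : ρ₀ < ρ₁)
    (h1 : ρ₁ < 1) {φ : Rn n → ℝ} (hφ : Measurable φ) (hfin : expLNorm ρ₀ (fun x => ‖φ x‖ₑ) < ⊤)
    {T : ℝ} (hT : 0 ≤ T) : ∃ c : ℕ → ENNReal, (∀ N, c N < ⊤) ∧ Tendsto c atTop (𝓝 0) ∧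
      ∀ N, ∀ t ∈ Icc 0 T,
        expLNorm ρ₁ (fun x => ∑' k, (majorant V)^[k + N] (fun _ y => ‖φ y‖ₑ) t x) ≤ c N := by
  obtain ⟨b, hb0, hbs, hb⟩ := exists_summable_bound hn hV hσ0 hσ1 h0 h01 h1 hT
  have hφm : Measurable (Function.uncurry fun (_ : ℝ) y => ‖φ y‖ₑ) :=
    (hφ.comp measurable_snd).enorm
  refine ⟨fun N => expLNorm ρ₀ (fun x => ‖φ x‖ₑ) * ENNReal.ofReal (∑' k, b (k + N)),
    fun N => ENNReal.mul_lt_top hfin ENNReal.ofReal_lt_top, ?_, fun N t ht => ?_⟩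
  · have h2 := (ENNReal.continuous_ofReal.tendsto 0).comp (tendsto_sum_nat_add b)
    have h3 := ENNReal.Tendsto.const_mul h2 (Or.inr hfin.ne)
    simpa using h3
  · exact expLNorm_tsum_iterate_le hV.measurable hφ hb0 hbs
      (fun k => hb _ _ hφm (fun _ _ => le_rfl) k t ht) N

theorem expLNorm_majorantSeries_lt_top {n : ℕ} (hn : 1 ≤ n) {V : Rn n → ℝ → ℝ} {σ : ℝ}
    (hV : GrowthBound V σ) (hσ0 : 0 ≤ σ) (hσ1 : σ < 1) {ρ₀ ρ₁ : ℝ} (h0 : 0 ≤ ρ₀) (h01 : ρ₀ < ρ₁)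
    (h1 : ρ₁ < 1) {φ : Rn n → ℝ} (hφ : Measurable φ) (hfin : expLNorm ρ₀ (fun x => ‖φ x‖ₑ) < ⊤)
    {t : ℝ} (ht : 0 ≤ t) : expLNorm ρ₁ (majorantSeries V φ t) < ⊤ := by
  obtain ⟨c, hc, -, hb⟩ := exists_tail_bound hn hV hσ0 hσ1 h0 h01 h1 hφ hfin ht
  exact (hb 0 t ⟨ht, le_rfl⟩).trans_lt (hc 0)

theorem ae_lt_top_of_expLNorm_lt_top {n : ℕ} {ρ : ℝ} {w : Rn n → ENNReal} (hw : Measurable w)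
    (h : expLNorm ρ w < ⊤) : ∀ᵐ x, w x < ⊤ := by
  filter_upwards [ae_lt_top ((measurable_expWeight ρ).mul hw) h.ne] with x hx
  refine lt_top_iff_ne_top.2 fun htop => hx.ne ?_
  rw [Pi.mul_apply, htop]
  exact ENNReal.mul_top (by simp [Real.exp_pos])

theorem abs_exp_neg_sub_exp_neg_le {s t : ℝ} (hs : 0 ≤ s) (hst : s ≤ t) :
    |Real.exp (-t) - Real.exp (-s)| ≤ t - s := by
  have h1 : Real.exp (-t) ≤ Real.exp (-s) := Real.exp_le_exp.2 (by linarith)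
  have h2 : Real.exp (-s) ≤ 1 := Real.exp_le_one_iff.2 (by linarith)
  have h3 : Real.exp (-t) = Real.exp (-s) * Real.exp (-(t - s)) := by
    rw [← Real.exp_add]; ring_nf
  have h4 := Real.add_one_le_exp (-(t - s))
  rw [abs_sub_comm, abs_of_nonneg (by linarith), h3]
  nlinarith [Real.exp_pos (-s)]

/-- The increment of `e^{-t} ∑ₖ 𝓑̂V(t)^k φ` splits into that of the integral and that of the factor
`e^{-t}`; both are controlled by the majorant series. -/
theorem enorm_exp_mul_picardSum_sub_le {n : ℕ} {V : Rn n → ℝ → ℝ}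
    (hV : Measurable (Function.uncurry V)) {φ : Rn n → ℝ} (hφ : Measurable φ) {s t T : ℝ}
    (hs : 0 ≤ s) (hst : s ≤ t) (htT : t ≤ T) {x : Rn n} (hx : majorantSeries V φ T x < ⊤) :
    ‖Real.exp (-t) * picardSum V φ t x - Real.exp (-s) * picardSum V φ s x‖ₑ ≤
      majorantOn V (majorantSeries V φ) (Ioc s t) x +
        ENNReal.ofReal (t - s) * majorantSeries V φ T x := by
  have ht : 0 ≤ t := hs.trans hst
  have hxt := (majorantSeries_mono_time V φ htT x).trans_lt hx
  have hxs := (majorantSeries_mono_time V φ hst x).trans_lt hxt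
  have hdef := hatBDefined_of_majorant_lt_top hV (measurable_picardSum hV hφ) ht
    (majorant_picardSum_lt_top hV hφ hxt)
  have e : Real.exp (-t) * picardSum V φ t x - Real.exp (-s) * picardSum V φ s x =
      Real.exp (-t) * (hatB V (picardSum V φ) t x - hatB V (picardSum V φ) s x) +
        (Real.exp (-t) - Real.exp (-s)) * picardSum V φ s x := by
    rw [picardSum_eq hV hφ ht hxt, picardSum_eq hV hφ hs hxs]
    ring
  rw [e]
  refine (enorm_add_le _ _).trans (add_le_add ?_ ?_)
  · rw [enorm_mul, Real.enorm_of_nonneg (Real.exp_pos _).le]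
    refine (mul_le_of_le_one_left zero_le ?_).trans
      ((enorm_hatB_sub_hatB_le hs hst hdef).trans ?_)
    · rw [← ENNReal.ofReal_one]
      exact ENNReal.ofReal_le_ofReal (Real.exp_le_one_iff.2 (by linarith))
    · refine setLIntegral_mono' measurableSet_Ioc fun τ hτ => lintegral_mono fun y => ?_
      exact mul_le_mul_right (enorm_picardSum_le V φ (hs.trans hτ.1.le) y) _
  · rw [enorm_mul, Real.enorm_eq_ofReal_abs]
    refine mul_le_mul' (ENNReal.ofReal_le_ofReal (abs_exp_neg_sub_exp_neg_le hs hst)) ?_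
    exact (enorm_picardSum_le V φ hs x).trans (majorantSeries_mono_time V φ (hst.trans htT) x)

/-- The curve `e^{-t} ∑ₖ 𝓑̂V(t)^k u₀` belongs to `C([0,∞); 𝓔)`: on `[0,T]` it takes its values in
one `𝓔_ρ`, and the integral equation makes it Lipschitz continuous in `𝓔_ρ'` for `ρ' > ρ`. -/
theorem exists_continuous_picardSum {n : ℕ} (hn : 1 ≤ n) {V : Rn n → ℝ → ℝ} {σ : ℝ}
    (hV : GrowthBound V σ) (hσ0 : 0 ≤ σ) (hσ1 : σ < 1) (u₀ : ExpSpace n) :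
    ∃ u : C(ℝ≥0, ExpSpace n), ∀ t : ℝ, 0 ≤ t →
      ∀ᵐ x, Real.exp t * (u t.toNNReal).toAE x = picardSum V u₀.toAE t x := by
  obtain ⟨ρ₀, hρ₀, hmem⟩ := u₀.2
  set φ : Rn n → ℝ := ⇑u₀.toAE
  have hφ : Measurable φ := u₀.toAE.measurable
  have hfin : expLNorm ρ₀ (fun x => ‖φ x‖ₑ) < ⊤ := mem_weightedL1_iff.1 hmem
  -- Any exponent strictly between `ρ₀` and `1` would do.
  set ρ₁ := (ρ₀ + 1) / 2 with hρ₁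
  have h01 : ρ₀ < ρ₁ := by linarith [hρ₀.2]
  have h11 : ρ₁ < 1 := by linarith [hρ₀.2]
  have h10 : 0 ≤ ρ₁ := by linarith [hρ₀.1]
  have hG : ∀ t, 0 ≤ t → expLNorm ρ₁ (majorantSeries V φ t) < ⊤ := fun t ht =>
    expLNorm_majorantSeries_lt_top hn hV hσ0 hσ1 hρ₀.1 h01 h11 hφ hfin ht
  have hGm : ∀ t, Measurable (majorantSeries V φ t) := fun t =>
    (measurable_majorantSeries hV.measurable hφ).comp (measurable_const.prodMk measurable_id)
  have hfm : ∀ t : ℝ≥0, AEStronglyMeasurable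
      (fun x => Real.exp (-t) * picardSum V φ t x) volume := fun t =>
    (((measurable_picardSum hV.measurable hφ).comp
      (measurable_const.prodMk measurable_id)).const_mul _).aestronglyMeasurable
  have hfmem : ∀ t : ℝ≥0, AEEqFun.mk _ (hfm t) ∈ weightedL1 n ρ₁ := by
    intro t
    refine mem_weightedL1_iff.2 (lt_of_le_of_lt (expLNorm_mono _ ?_) (hG t t.2))
    filter_upwards [AEEqFun.coeFn_mk _ (hfm t)] with x hx
    rw [hx, enorm_mul, Real.enorm_of_nonneg (Real.exp_pos _).le]
    refine (mul_le_of_le_one_left zero_le ?_).trans (enorm_picardSum_le V φ t.2 x)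
    rw [← ENNReal.ofReal_one]
    exact ENNReal.ofReal_le_ofReal (Real.exp_le_one_iff.2 (by linarith [t.2]))
  let u : ℝ≥0 → ExpSpace n := fun t => ⟨AEEqFun.mk _ (hfm t), ρ₁, ⟨h10, h11⟩, hfmem t⟩
  have hu : ∀ t : ℝ≥0, ∀ᵐ x, (u t).toAE x = Real.exp (-t) * picardSum V φ t x := fun t =>
    AEEqFun.coeFn_mk _ (hfm t)
  have hcont : Continuous u := by
    refine continuous_of_lipschitz_step fun T => ?_
    set δ := (1 - ρ₁) / 2 with hδ
    have hδ0 : 0 < δ := by linarith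
    have hρ₂ : ρ₁ + δ < 1 := by linarith
    obtain ⟨C, hC, hCV⟩ := hV.bound T
    set K : ENNReal := besselMoment n (ρ₁ + δ) * ENNReal.ofReal (C * (2 * δ ^ (-σ))) *
      expLNorm ρ₁ (majorantSeries V φ T) with hK
    set M : ENNReal := expLNorm (ρ₁ + δ) (majorantSeries V φ T) with hM
    have hKtop : K < ⊤ := ENNReal.mul_lt_top (ENNReal.mul_lt_top
      (besselMoment_lt_top hn (by linarith) hρ₂) ENNReal.ofReal_lt_top) (hG T T.2)
    have hMtop : M < ⊤ := (expLNorm_anti (by linarith) _).trans_lt (hG T T.2)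
    have hKM : K + M ≠ ⊤ := (ENNReal.add_lt_top.2 ⟨hKtop, hMtop⟩).ne
    refine ⟨ρ₁ + δ, ⟨by linarith, hρ₂⟩, (K + M).toReal, fun s t hst htT => ?_⟩
    have hst' : (s : ℝ) ≤ t := NNReal.coe_le_coe.2 hst
    have htT' : (t : ℝ) ≤ T := NNReal.coe_le_coe.2 htT
    have hsub : Ioc (s : ℝ) t ⊆ Ioc 0 (T : ℝ) := Ioc_subset_Ioc s.2 htT'
    have h1 : expLNorm (ρ₁ + δ) (majorantOn V (majorantSeries V φ) (Ioc s t)) ≤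
        K * ENNReal.ofReal (t - s) := by
      refine (expLNorm_majorantOn_le hV.measurable hC hCV hσ0 hσ1.le h10 hδ0 (by linarith) le_rfl
        (measurable_majorantSeries hV.measurable hφ) measurableSet_Ioc hsub).trans ?_
      rw [← Real.volume_Ioc, ← setLIntegral_const]
      refine setLIntegral_mono' measurableSet_Ioc fun τ hτ => ?_
      refine mul_le_mul_right (expLNorm_mono _ (ae_of_all _ fun x => ?_)) _
      exact majorantSeries_mono_time V φ (hτ.2.trans htT') x
    have h2 : expLNorm (ρ₁ + δ) (fun x => ‖(u t - u s).toAE x‖ₑ) ≤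
        ENNReal.ofReal ((K + M).toReal * (t - s)) := by
      calc expLNorm (ρ₁ + δ) (fun x => ‖(u t - u s).toAE x‖ₑ)
          ≤ expLNorm (ρ₁ + δ) (fun x => majorantOn V (majorantSeries V φ) (Ioc s t) x +
              ENNReal.ofReal (t - s) * majorantSeries V φ T x) := by
            refine expLNorm_mono _ ?_
            filter_upwards [ExpSpace.toAE_sub_ae (u t) (u s), hu t, hu s,
              ae_lt_top_of_expLNorm_lt_top (hGm T) (hG T T.2)] with x e1 e2 e3 e4
            rw [e1, e2, e3]
            exact enorm_exp_mul_picardSum_sub_le hV.measurable hφ s.2 hst' htT' e4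
        _ = expLNorm (ρ₁ + δ) (majorantOn V (majorantSeries V φ) (Ioc s t)) +
              ENNReal.ofReal (t - s) * M := by
            rw [hM, expLNorm, expLNorm, expLNorm,
              ← lintegral_const_mul' _ _ ENNReal.ofReal_ne_top, ← lintegral_add_right]
            · refine lintegral_congr fun x => ?_
              ring
            · exact ((measurable_expWeight _).mul (hGm T)).const_mul _
        _ ≤ K * ENNReal.ofReal (t - s) + ENNReal.ofReal (t - s) * M := by gcongr
        _ = (K + M) * ENNReal.ofReal (t - s) := by ring
        _ = _ := by
            rw [ENNReal.ofReal_mul ENNReal.toReal_nonneg, ENNReal.ofReal_toReal hKM]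
    have h3 : (u t - u s).toAE ∈ weightedL1 n (ρ₁ + δ) :=
      mem_weightedL1_iff.2 (h2.trans_lt ENNReal.ofReal_lt_top)
    refine ⟨h3, ?_⟩
    rw [← ofReal_weightedNorm h3] at h2
    exact (ENNReal.ofReal_le_ofReal_iff
      (mul_nonneg ENNReal.toReal_nonneg (sub_nonneg.2 hst'))).1 h2
  refine ⟨⟨u, hcont⟩, fun t ht => ?_⟩
  filter_upwards [hu t.toNNReal] with x hx
  have hx' : ((⟨u, hcont⟩ : C(ℝ≥0, ExpSpace n)) t.toNNReal).toAE x =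
      Real.exp (-t) * picardSum V φ t x := by
    rw [Real.coe_toNNReal t ht] at hx
    exact hx
  rw [hx', ← mul_assoc, ← Real.exp_add]
  simp

/-- The integral equation involves `u(τ)` and `V(·,τ)` only up to null sets in space, so it passes
from the sum of the Picard series for `V` to arbitrary representatives for `a + 1`. -/
theorem isMildSolution_of_ae_eq_picardSum {n : ℕ} {a V : Rn n → ℝ → ℝ}
    (hV : Measurable (Function.uncurry V)) (haV : ∀ᵐ τ : ℝ, 0 ≤ τ → ∀ᵐ y, a y τ + 1 = V y τ)
    {u₀ : ExpSpace n} {u : C(ℝ≥0, ExpSpace n)}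
    (hG : ∀ t, 0 ≤ t → ∀ᵐ x, majorantSeries V u₀.toAE t x < ⊤)
    (hu : ∀ t : ℝ, 0 ≤ t →
      ∀ᵐ x, Real.exp t * (u t.toNNReal).toAE x = picardSum V u₀.toAE t x) :
    IsMildSolution a u₀ u := by
  intro t ht
  let V₁ : Rn n → ℝ → ℝ := fun y τ => a y τ + 1
  let μ : ℝ → Rn n → ℝ := fun τ y => Real.exp τ * (u τ.toNNReal).toAE y
  have hφ : Measurable u₀.toAE := u₀.toAE.measurable
  have haV' : ∀ᵐ τ : ℝ, 0 ≤ τ → ∀ᵐ y, V y τ = V₁ y τ :=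
    haV.mono fun τ h h0 => (h h0).mono fun y hy => hy.symm
  have hμ : ∀ τ, 0 ≤ τ → ∀ᵐ y, picardSum V u₀.toAE τ y = μ τ y := fun τ h0 =>
    (hu τ h0).mono fun y hy => hy.symm
  filter_upwards [hG t ht, hμ t ht] with x h1 h2
  refine ⟨(hatBDefined_of_majorant_lt_top hV (measurable_picardSum hV hφ) ht
    (majorant_picardSum_lt_top hV hφ h1)).congr haV' hμ ht, ?_⟩
  change μ t x = u₀.toAE x + hatB V₁ μ t x
  rw [← h2, picardSum_eq hV hφ ht h1, hatB_congr haV' hμ ht]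

/-! ### Positivity -/

theorem picardTerm_nonneg {n : ℕ} {V : Rn n → ℝ → ℝ}
    (hV : ∀ᵐ τ : ℝ, 0 ≤ τ → ∀ᵐ y, 0 ≤ V y τ) {φ : Rn n → ℝ} (hφ : ∀ᵐ y, 0 ≤ φ y) (k : ℕ) :
    ∀ t, 0 ≤ t → ∀ᵐ x, 0 ≤ picardTerm V φ k t x := by
  induction k with
  | zero => exact fun _ _ => hφ
  | succ k ih =>
    refine fun t ht => ae_of_all _ fun x => ?_
    change 0 ≤ hatB V (picardTerm V φ k) t x
    rw [hatB, intervalIntegral.integral_of_le ht]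
    refine integral_nonneg_of_ae ?_
    filter_upwards [ae_Ioc_of_ae_nonneg hV t,
      (ae_restrict_mem measurableSet_Ioc : ∀ᵐ τ ∂(volume.restrict (Ioc (0 : ℝ) t)), _)]
      with τ h1 h2
    refine integral_nonneg_of_ae ?_
    filter_upwards [h1, ih τ h2.1.le] with y h3 h4
    exact mul_nonneg (besselKernel_nonneg _ _) (mul_nonneg h3 h4)

/-! ### Global well-posedness -/

theorem mainTheorem2 (n : ℕ) (hn : 1 ≤ n) (a : Rn n → ℝ → ℝ) (Λ : ℝ → ℝ) (σ : ℝ)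
    (ha : LocallyIntegrableOn (fun p : Rn n × ℝ => a p.1 p.2) (univ ×ˢ Ici (0 : ℝ)))
    (hΛ : ∀ T : ℝ, BddAbove (Λ '' Icc 0 T))
    (hσ : σ ∈ Ico (0 : ℝ) 1)
    (hbound : ∀ᵐ p : Rn n × ℝ, 0 ≤ p.2 → |a p.1 p.2| ≤ Λ p.2 * ‖p.1‖ ^ σ)
    (u₀ : ExpSpace n) :
    (∃! u : C(ℝ≥0, ExpSpace n), IsMildSolution a u₀ u) ∧
    ∀ u : C(ℝ≥0, ExpSpace n), IsMildSolution a u₀ u →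
      -- the terms of the Picard series are well defined and the series converges to `eᵗ u(t)`
      (∀ t : ℝ≥0, ∀ᵐ x : Rn n,
        (∀ k : ℕ, HatBDefined (fun y τ => a y τ + 1)
          (picardTerm (fun y τ => a y τ + 1) u₀.toAE k) t x) ∧
        HasSum (fun k : ℕ => picardTerm (fun y τ => a y τ + 1) u₀.toAE k t x)
          (Real.exp t * (u t).toAE x)) ∧
      -- the convergence also holds in some `𝓔_ρ`, uniformly on each bounded time interval
      (∀ T : ℝ≥0, ∃ ρ ∈ Ico (0 : ℝ) 1, ∀ ε : ℝ, 0 < ε → ∃ N₀ : ℕ, ∀ N ≥ N₀, ∀ t : ℝ≥0, t ≤ T →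
        ∫⁻ x : Rn n, ENNReal.ofReal (Real.exp (-ρ * ‖x‖) *
          |∑ k ∈ Finset.range N, picardTerm (fun y τ => a y τ + 1) u₀.toAE k t x
            - Real.exp t * (u t).toAE x|) ≤ ENNReal.ofReal ε) ∧
      -- nonnegativity
      ((∀ᵐ p : Rn n × ℝ, 0 ≤ p.2 → 0 ≤ a p.1 p.2) → 0 ≤ u₀.toAE → ∀ t : ℝ≥0, 0 ≤ (u t).toAE) := by
  obtain ⟨V, hV, haV⟩ := exists_growthBound_ae_eq ha hΛ hbound
  obtain ⟨ρ₀, hρ₀, hmem⟩ := u₀.2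
  have hφ : Measurable u₀.toAE := u₀.toAE.measurable
  have hfin : expLNorm ρ₀ (fun x => ‖u₀.toAE x‖ₑ) < ⊤ := mem_weightedL1_iff.1 hmem
  have h01 : ρ₀ < (ρ₀ + 1) / 2 := by linarith [hρ₀.2]
  have h11 : (ρ₀ + 1) / 2 < 1 := by linarith [hρ₀.2]
  have hG : ∀ t, 0 ≤ t → ∀ᵐ x, majorantSeries V u₀.toAE t x < ⊤ := fun t ht =>
    ae_lt_top_of_expLNorm_lt_top ((measurable_majorantSeries hV.measurable hφ).comp
      (measurable_const.prodMk measurable_id))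
      (expLNorm_majorantSeries_lt_top hn hV hσ.1 hσ.2 hρ₀.1 h01 h11 hφ hfin ht)
  obtain ⟨u, hu⟩ := exists_continuous_picardSum hn hV hσ.1 hσ.2 u₀
  have humild : IsMildSolution a u₀ u := isMildSolution_of_ae_eq_picardSum hV.measurable haV hG hu
  refine ⟨⟨u, humild, fun v hv => hv.unique hn hV hσ.1 hσ.2 haV humild⟩, fun v hv => ?_⟩
  obtain rfl := hv.unique hn hV hσ.1 hσ.2 haV humild
  have hpic := picardTerm_congr haV u₀.toAE
  have hut : ∀ t : ℝ≥0, ∀ᵐ x, Real.exp t * (v t).toAE x = picardSum V u₀.toAE t x := fun t => by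
    have := hu t t.2
    rwa [Real.toNNReal_coe] at this
  have hsum : ∀ t : ℝ≥0, ∀ᵐ x,
      (∀ k : ℕ, HatBDefined (fun y τ => a y τ + 1)
        (picardTerm (fun y τ => a y τ + 1) u₀.toAE k) t x) ∧
      HasSum (fun k : ℕ => picardTerm (fun y τ => a y τ + 1) u₀.toAE k t x)
        (Real.exp t * (v t).toAE x) := by
    intro t
    filter_upwards [hG t t.2, hut t] with x h1 h2
    refine ⟨fun k => (hatBDefined_picardTerm hV.measurable hφ t.2 h1 k).congr
      (haV.mono fun τ h h0 => (h h0).mono fun y hy => hy.symm)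
      (fun τ h0 => ae_of_all _ fun y => by rw [hpic k τ h0]) t.2, ?_⟩
    simp_rw [hpic _ _ t.coe_nonneg]
    rw [h2]
    exact (summable_picardTerm t.2 h1).hasSum
  refine ⟨hsum, fun T => ?_, fun ha0 hu0 t => ?_⟩
  · obtain ⟨c, -, hc0, hc⟩ :=
      exists_tail_bound hn hV hσ.1 hσ.2 hρ₀.1 h01 h11 hφ hfin T.2
    refine ⟨(ρ₀ + 1) / 2, ⟨by linarith [hρ₀.1], h11⟩, fun ε hε => ?_⟩
    obtain ⟨N₀, hN₀⟩ := eventually_atTop.1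
      (hc0.eventually_lt_const (ENNReal.ofReal_pos.2 hε))
    refine ⟨N₀, fun N hN t htT => ?_⟩
    refine le_trans ?_ ((hc N t ⟨t.2, NNReal.coe_le_coe.2 htT⟩).trans (hN₀ N hN).le)
    refine lintegral_mono_ae ?_
    filter_upwards [hG t t.2, hut t] with x h1 h2
    simp_rw [hpic _ _ t.coe_nonneg]
    rw [h2, ENNReal.ofReal_mul (Real.exp_pos _).le, ← Real.enorm_eq_ofReal_abs]
    exact mul_le_mul_right (enorm_picardSum_sub_sum_le t.2 h1 N) _
  · have hV0 : ∀ᵐ τ : ℝ, 0 ≤ τ → ∀ᵐ y, 0 ≤ a y τ + 1 := by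
      have hsw : ∀ᵐ q : ℝ × Rn n, 0 ≤ q.1 → 0 ≤ a q.2 q.1 :=
        (Measure.measurePreserving_swap (μ := (volume : Measure ℝ))
          (ν := (volume : Measure (Rn n)))).quasiMeasurePreserving.ae ha0
      filter_upwards [Measure.ae_ae_of_ae_prod hsw] with τ hτ h0
      exact hτ.mono fun y hy => add_nonneg (hy h0) zero_le_one
    have hφ0 : ∀ᵐ y, 0 ≤ u₀.toAE y := by
      filter_upwards [AEEqFun.coeFn_le.2 hu0,
        AEEqFun.coeFn_zero (α := Rn n) (μ := volume) (β := ℝ)] with y h1 h2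
      rw [h2] at h1
      exact h1
    refine AEEqFun.coeFn_le.1 ?_
    filter_upwards [hsum t, ae_all_iff.2 fun k => picardTerm_nonneg hV0 hφ0 k t t.2,
      AEEqFun.coeFn_zero (α := Rn n) (μ := volume) (β := ℝ)] with x h1 h2 h3
    rw [h3]
    exact nonneg_of_mul_nonneg_right (h1.2.nonneg h2) (Real.exp_pos _)

end
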